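/- Let $(X_1,Y_1),\dots,(X_{m+1},Y_{m+1})$ ($m\ge 1$) be random data points on a probability space, let $R(\cdot,\cdot)$ be a real-valued score function, and suppose that the scores $R_i = R(X_i,Y_i)$, $i=1,\dots,m+1$, are independent random variables with continuous (atomless), possibly different, distributions. Let $0<\alpha<1$. Let $R_{(1)}\le\dots\le R_{(m)}$ be the order statistics of the calibration scores $R_1,\dots,R_m$, with the convention $R_{(m+1)}=+\infty$, and define the split conformal prediction set and its modification \[ \widehat C_{m,\alpha}(X_{m+1}) = \{y : R(X_{m+1},y)\le R_{(\lceil (m+1)(1-\alpha)\rceil)}\},\qquad \widehat C^{\mathrm{mod}}_{m,\alpha}(X_{m+1}) = \{y : R(X_{m+1},y)\le R_{(m+1-\lfloor 2m\alpha/3\rfloor)}\}. \] For probability measures $\nu_1,\nu_2$ on $\mathbb R$ let $d_{\mathrm{KS}}(\nu_1,\nu_2)=\sup_{b\in\mathbb R}|\nu_1(-\infty,b]-\nu_2(-\infty,b]|$; for random variables or distribution functions, $d_{\mathrm{KS}}$ denotes the distance of the corresponding laws. Put $F_i(z)=\mathbb P(R_i<z)$ for $i\le m+1$, $\kappa_i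 = d_{\mathrm{KS}}(F_i,F_{m+1})$ for $i\le m$, $\overline F(z)=\frac1m\sum_{i=1}^m F_i(z)$, let $U$ be uniformly distributed on $(0,1)$, and let \[ I_m = \begin{cases} 1 & \text{if } m\le 4,\\ 1-\sqrt{1-\frac4m}+\frac2m\log\left(\frac{1+\sqrt{1-4/m}}{1-\sqrt{1-4/m}}\right) & \text{if } m>4.\end{cases} \] Then \[ -\delta \le \mathbb P\big(Y_{m+1}\in\widehat C_{m,\alpha}(X_{m+1})\big)-(1-\alpha)\le \frac1{m+1}+\delta, \] where \[ \delta = d_{\mathrm{KS}}(\overline F(R_{m+1}),U)+\Big(\sum_{i=1}^m\kappa_i^2\Big)\Big[I_m+d_{\mathrm{KS}}(\overline F(R_{m+1}),U)\Big], \] and moreover \[ \mathbb P\big(Y_{m+1}\in\widehat C^{\mathrm{mod}}_{m,\alpha}(X_{m+1})\big)-(1-\alpha)\ge -3\,d_{\mathrm{KS}}(\overline F(R_{m+1}),U). \] -/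

import Mathlib

open MeasureTheory ProbabilityTheory

namespace SplitConformal

noncomputable section

/-- Kolmogorov–Smirnov distance between two laws on the line,
`sup_b |ν₁(-∞, b] - ν₂(-∞, b]|`. The supremum is of a bounded family for probability measures. -/
def ksDist (ν₁ ν₂ : Measure ℝ) : ℝ :=
  ⨆ b : ℝ, |ν₁.real (Set.Iic b) - ν₂.real (Set.Iic b)|

/-- The uniform distribution `U(0,1)`. -/
def uniform01 : Measure ℝ := volume.restrict (Set.Ioo 0 1)

/-- The `k`-th smallest (`k = 1, …, m`) of the values `v 0, …, v (m-1)`, counted with multiplicity.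
By convention the order statistic of rank `0` is `-∞` and every order statistic of rank
larger than `m` is `+∞`. -/
def orderStat {m : ℕ} (v : Fin m → ℝ) (k : ℕ) : EReal :=
  if k = 0 then ⊥
  else if h : k - 1 < m then ((v (Tuple.sort v ⟨k - 1, h⟩) : ℝ) : EReal)
  else ⊤

/-- The prediction set `{y : R(x', y) ≤ R_(k)}` at the test point `x'`, where `R_(k)` is the `k`-th
order statistic of the calibration scores `R(x i, y i)`. -/
def predSet {𝒳 𝒴 : Type*} {m : ℕ} (R : 𝒳 → 𝒴 → ℝ) (x : Fin m → 𝒳) (y : Fin m → 𝒴)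
    (k : ℕ) (x' : 𝒳) : Set 𝒴 :=
  {y' | (R x' y' : EReal) ≤ orderStat (fun i => R (x i) (y i)) k}

/-- The split conformal prediction set, of rank `⌈(m+1)(1-α)⌉`. -/
def conformalSet {𝒳 𝒴 : Type*} {m : ℕ} (R : 𝒳 → 𝒴 → ℝ) (x : Fin m → 𝒳) (y : Fin m → 𝒴)
    (α : ℝ) (x' : 𝒳) : Set 𝒴 :=
  predSet R x y ⌈((m : ℝ) + 1) * (1 - α)⌉₊ x'

/-- The modified prediction set, of rank `m + 1 - ⌊2mα/3⌋`. The subtraction does not truncate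
for `α ≤ 1`. -/
def modConformalSet {𝒳 𝒴 : Type*} {m : ℕ} (R : 𝒳 → 𝒴 → ℝ) (x : Fin m → 𝒳) (y : Fin m → 𝒴)
    (α : ℝ) (x' : 𝒳) : Set 𝒴 :=
  predSet R x y (m + 1 - ⌊2 * (m : ℝ) * α / 3⌋₊) x'

/-- The constant `I_B`. -/
def IConst (B : ℕ) : ℝ :=
  if B ≤ 4 then 1
  else 1 - √(1 - 4 / (B : ℝ)) +
    2 / (B : ℝ) * Real.log ((1 + √(1 - 4 / (B : ℝ))) / (1 - √(1 - 4 / (B : ℝ))))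

variable {Ω : Type*} [MeasurableSpace Ω]

/-- `F(z) = P(S < z)`. -/
def strictCDF (P : Measure Ω) (S : Ω → ℝ) (z : ℝ) : ℝ := P.real {ω | S ω < z}

/-- `F̄(z) = (1/m) ∑_{i ≤ m} P(S_i < z)`, the average over the calibration scores; the test score
is the last one. -/
def avgCDF {m : ℕ} (P : Measure Ω) (S : Fin (m + 1) → Ω → ℝ) (z : ℝ) : ℝ :=
  (1 / (m : ℝ)) * ∑ i : Fin m, strictCDF P (S i.castSucc) z

/-- `d_KS(F̄(S_{m+1}), U(0,1))`. -/
def avgKS {m : ℕ} (P : Measure Ω) (S : Fin (m + 1) → Ω → ℝ) : ℝ :=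
  ksDist (P.map (fun ω => avgCDF P S (S (Fin.last m) ω))) uniform01

/-- `κ_i = d_KS(S_i, S_{m+1})`. -/
def kappa {m : ℕ} (P : Measure Ω) (S : Fin (m + 1) → Ω → ℝ) (i : Fin m) : ℝ :=
  ksDist (P.map (S i.castSucc)) (P.map (S (Fin.last m)))

/-- `δ = d_KS(F̄(S_{m+1}), U) + (∑ κ_i²) (I_m + d_KS(F̄(S_{m+1}), U))`. -/
def slack {m : ℕ} (P : Measure Ω) (S : Fin (m + 1) → Ω → ℝ) : ℝ :=
  avgKS P S + (∑ i : Fin m, kappa P S i ^ 2) * (IConst m + avgKS P S)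

end

end SplitConformal

/-!
Given that the test score equals `z`, the number of calibration scores below it is a sum of
independent Bernoulli variables with parameters `F_i(z)`, whose mean parameter is `F̄(z)`. The
conformal set covers exactly when this number is smaller than the rank, so the coverage probability
is the average of the distribution function of such a sum over the law of the test score.

This law is compared with the binomial law of parameter `a = F̄(z)`: interpolating from `(a, …, a)`
to `(F_i(z))_i` shows that they differ by at most `(1 / 2) ∑ (F_i(z) - a)²`, and Stein's method,
with Ehm's bound on the increments of the solution of the binomial Stein equation, that they differ
by at most `∑ (F_i(z) - a)² / (m a (1 - a))`. Both use that `∑ (F_i(z) - a) = 0`, so that sums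
weighted by `F_i(z) - a` only see differences of their terms. The sum of squares is at most
`∑ κ_i²` because `a` is the mean of the `F_i(z)`.

Finally, the law of `F̄(R_{m+1})` is replaced by the uniform law, at the cost of their
Kolmogorov–Smirnov distance times the total variation of the integrand; under the uniform law
the binomial distribution function integrates to `k / (m + 1)` and the error factor to at most
`I_m`. For the modified set a Chernoff bound takes the place of the binomial law, and its integral
under the uniform law is at most `(3 / 2) t / m` when the rank is `m + 1 - t`.
-/

namespace SplitConformal

open Finset fwdDiff

section BernoulliSums

variable {ι : Type*} [DecidableEq ι]

/-- The expectation of `φ (∑ i ∈ s, B i)` for independent Bernoulli variables `B i` with success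
probabilities `p i`, as a linear functional of `φ`; the sum runs over the set `T` of successes. -/
noncomputable def bernoulliExp (s : Finset ι) (p : ι → ℝ) : (ℕ → ℝ) →ₗ[ℝ] ℝ :=
  ∑ T ∈ s.powerset, ((∏ i ∈ T, p i) * ∏ i ∈ s \ T, (1 - p i)) • LinearMap.proj #T

lemma bernoulliExp_apply (s : Finset ι) (p : ι → ℝ) (φ : ℕ → ℝ) :
    bernoulliExp s p φ =
      ∑ T ∈ s.powerset, ((∏ i ∈ T, p i) * ∏ i ∈ s \ T, (1 - p i)) * φ #T := by
  simp [bernoulliExp, LinearMap.sum_apply]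

lemma bernoulliExp_empty (p : ι → ℝ) (φ : ℕ → ℝ) : bernoulliExp ∅ p φ = φ 0 := by
  simp [bernoulliExp_apply]

lemma bernoulliExp_insert {s : Finset ι} {b : ι} (hb : b ∉ s) (p : ι → ℝ) (φ : ℕ → ℝ) :
    bernoulliExp (insert b s) p φ =
      (1 - p b) * bernoulliExp s p φ + p b * bernoulliExp s p fun j ↦ φ (j + 1) := by
  simp only [bernoulliExp_apply, sum_powerset_insert hb, mul_sum]
  congr 1 <;> refine sum_congr rfl fun T hT ↦ ?_
  · have hbT : b ∉ T := fun h ↦ hb (mem_powerset.1 hT h)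
    rw [insert_sdiff_of_notMem _ hbT, prod_insert (by simp [hb])]
    ring
  · have hbT : b ∉ T := fun h ↦ hb (mem_powerset.1 hT h)
    rw [insert_sdiff_insert, sdiff_insert_of_notMem hb, prod_insert hbT, card_insert_of_notMem hbT]
    ring

lemma bernoulliExp_of_mem {s : Finset ι} {i : ι} (hi : i ∈ s) (p : ι → ℝ) (φ : ℕ → ℝ) :
    bernoulliExp s p φ = (1 - p i) * bernoulliExp (s.erase i) p φ +
      p i * bernoulliExp (s.erase i) p fun j ↦ φ (j + 1) := by
  rw [← bernoulliExp_insert (notMem_erase i s), insert_erase hi]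

lemma bernoulliExp_const (s : Finset ι) (p : ι → ℝ) (c : ℝ) :
    bernoulliExp s p (fun _ ↦ c) = c := by
  induction s using Finset.induction_on with
  | empty => exact bernoulliExp_empty p _
  | insert b s hb ih => rw [bernoulliExp_insert hb, ih]; ring

lemma bernoulliExp_mono {s : Finset ι} {p : ι → ℝ} {φ ψ : ℕ → ℝ} (hp : ∀ i ∈ s, p i ∈ Set.Icc 0 1)
    (h : ∀ j ≤ #s, φ j ≤ ψ j) : bernoulliExp s p φ ≤ bernoulliExp s p ψ := by
  simp only [bernoulliExp_apply]
  refine sum_le_sum fun T hT ↦ mul_le_mul_of_nonneg_left (h _ (card_le_card (mem_powerset.1 hT))) ?_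
  exact mul_nonneg (prod_nonneg fun i hi ↦ (hp i (mem_powerset.1 hT hi)).1)
    (prod_nonneg fun i hi ↦ sub_nonneg.2 (hp i (mem_sdiff.1 hi).1).2)

lemma bernoulliExp_congr {s : Finset ι} (p : ι → ℝ) {φ ψ : ℕ → ℝ}
    (h : ∀ j ≤ #s, φ j = ψ j) : bernoulliExp s p φ = bernoulliExp s p ψ := by
  simp only [bernoulliExp_apply]
  exact sum_congr rfl fun T hT ↦ by rw [h _ (card_le_card (mem_powerset.1 hT))]

lemma abs_bernoulliExp_le {s : Finset ι} {p : ι → ℝ} {φ : ℕ → ℝ} {c : ℝ}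
    (hp : ∀ i ∈ s, p i ∈ Set.Icc 0 1) (h : ∀ j ≤ #s, |φ j| ≤ c) : |bernoulliExp s p φ| ≤ c := by
  refine abs_le.2 ⟨?_, ?_⟩
  · simpa only [bernoulliExp_const] using
      bernoulliExp_mono (φ := fun _ ↦ -c) hp fun j hj ↦ (abs_le.1 (h j hj)).1
  · simpa only [bernoulliExp_const] using
      bernoulliExp_mono (ψ := fun _ ↦ c) hp fun j hj ↦ (abs_le.1 (h j hj)).2

lemma bernoulliExp_fwdDiff (s : Finset ι) (p : ι → ℝ) (φ : ℕ → ℝ) :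
    bernoulliExp s p (Δ_[1] φ) = (bernoulliExp s p fun j ↦ φ (j + 1)) - bernoulliExp s p φ :=
  map_sub _ _ _

lemma bernoulliExp_erase_sub {s : Finset ι} {i j : ι} (hi : i ∈ s) (hj : j ∈ s) (hij : i ≠ j)
    (p : ι → ℝ) (φ : ℕ → ℝ) :
    bernoulliExp (s.erase i) p φ - bernoulliExp (s.erase j) p φ =
      (p j - p i) * bernoulliExp ((s.erase i).erase j) p (Δ_[1] φ) := by
  rw [bernoulliExp_of_mem (mem_erase.2 ⟨hij.symm, hj⟩), bernoulliExp_of_mem (mem_erase.2 ⟨hij, hi⟩),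
    erase_right_comm (a := j), bernoulliExp_fwdDiff]
  ring

lemma bernoulliExp_reflect (s : Finset ι) (p : ι → ℝ) (φ : ℕ → ℝ) :
    bernoulliExp s p φ = bernoulliExp s (fun i ↦ 1 - p i) fun j ↦ φ (#s - j) := by
  simp only [bernoulliExp_apply, sub_sub_cancel]
  refine sum_nbij' (s \ ·) (s \ ·) ?_ ?_ ?_ ?_ ?_
  · simp
  · simp
  · simp +contextual
  · simp +contextual
  · intro T hT
    have hT := mem_powerset.1 hT
    have := card_le_card hT
    rw [Finset.sdiff_sdiff_eq_self hT, card_sdiff_of_subset hT, mul_comm (∏ i ∈ T, p i),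
      Nat.sub_sub_self this]

lemma sum_mul_bernoulliExp_erase_insert {s : Finset ι} {b : ι} (hb : b ∉ s) (c p : ι → ℝ)
    (φ : ℕ → ℝ) :
    ∑ i ∈ insert b s, c i * bernoulliExp ((insert b s).erase i) p φ =
      c b * bernoulliExp s p φ + (1 - p b) * (∑ i ∈ s, c i * bernoulliExp (s.erase i) p φ) +
        p b * ∑ i ∈ s, c i * bernoulliExp (s.erase i) p fun j ↦ φ (j + 1) := by
  rw [sum_insert hb, erase_insert hb, add_assoc, mul_sum, mul_sum, ← sum_add_distrib]
  refine congrArg _ (sum_congr rfl fun i hi ↦ ?_)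
  rw [erase_insert_of_ne (ne_of_mem_of_not_mem hi hb).symm,
    bernoulliExp_insert fun h ↦ hb (mem_of_mem_erase h)]
  ring

lemma bernoulliExp_natCast_mul (s : Finset ι) (p : ι → ℝ) (φ : ℕ → ℝ) :
    (bernoulliExp s p fun j ↦ (j : ℝ) * φ j) =
      ∑ i ∈ s, p i * bernoulliExp (s.erase i) p fun j ↦ φ (j + 1) := by
  induction s using Finset.induction_on generalizing φ with
  | empty => simp [bernoulliExp_empty]
  | insert b s hb ih =>
    have hshift : (bernoulliExp s p fun j ↦ ((j + 1 : ℕ) : ℝ) * φ (j + 1)) =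
        (bernoulliExp s p fun j ↦ (j : ℝ) * φ (j + 1)) + bernoulliExp s p fun j ↦ φ (j + 1) := by
      rw [← map_add]
      exact congrArg _ (funext fun j ↦ by simp; ring)
    rw [bernoulliExp_insert hb, hshift, ih, ih, sum_mul_bernoulliExp_erase_insert hb]
    ring

lemma bernoulliExp_card_sub_mul (s : Finset ι) (p : ι → ℝ) (φ : ℕ → ℝ) :
    (bernoulliExp s p fun j ↦ ((#s : ℝ) - j) * φ j) =
      ∑ i ∈ s, (1 - p i) * bernoulliExp (s.erase i) p φ := by
  have hsplit : (fun j : ℕ ↦ ((#s : ℝ) - j) * φ j) =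
      (#s : ℝ) • φ - fun j : ℕ ↦ (j : ℝ) * φ j := by
    ext j; simp [sub_mul]
  have hmem : ∀ i ∈ s, (1 - p i) * bernoulliExp (s.erase i) p φ = bernoulliExp s p φ -
      p i * bernoulliExp (s.erase i) p fun j ↦ φ (j + 1) := fun i hi ↦ by
    rw [bernoulliExp_of_mem hi, add_sub_cancel_right]
  rw [hsplit, map_sub, map_smul, bernoulliExp_natCast_mul, sum_congr rfl hmem, sum_sub_distrib]
  simp

lemma bernoulliExp_pow (s : Finset ι) (p : ι → ℝ) (x : ℝ) :
    (bernoulliExp s p fun j ↦ x ^ j) = ∏ i ∈ s, (1 - p i + p i * x) := by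
  simp_rw [bernoulliExp_apply, add_comm (1 - p _), prod_add, prod_mul_distrib, prod_const]
  exact sum_congr rfl fun T _ ↦ by ring

lemma hasDerivAt_bernoulliExp {s : Finset ι} {p : ℝ → ι → ℝ} {p' : ι → ℝ} {t : ℝ}
    (hp : ∀ i ∈ s, HasDerivAt (p · i) (p' i) t) (φ : ℕ → ℝ) :
    HasDerivAt (fun t ↦ bernoulliExp s (p t) φ)
      (∑ i ∈ s, p' i * bernoulliExp (s.erase i) (p t) (Δ_[1] φ)) t := by
  induction s using Finset.induction_on generalizing φ with
  | empty => simpa only [bernoulliExp_empty, sum_empty] using hasDerivAt_const t (φ 0)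
  | insert b s hb ih =>
    have hs := ih fun i hi ↦ hp i (mem_insert_of_mem hi)
    have hpb := hp b (mem_insert_self b s)
    simp_rw [bernoulliExp_insert hb]
    refine (((hpb.const_sub 1).mul (hs φ)).add (hpb.mul (hs fun j ↦ φ (j + 1)))).congr_deriv ?_
    have hcomm : (Δ_[1] fun j ↦ φ (j + 1)) = fun j ↦ (Δ_[1] φ) (j + 1) := rfl
    rw [sum_mul_bernoulliExp_erase_insert hb, bernoulliExp_fwdDiff, hcomm]
    ring

lemma sum_sum_sub_mul_sub {κ R : Type*} [CommRing R] (s : Finset κ) (d b : κ → R) :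
    ∑ i ∈ s, ∑ j ∈ s, (d i - d j) * (b i - b j) =
      2 * (#s * ∑ i ∈ s, d i * b i - (∑ i ∈ s, d i) * ∑ i ∈ s, b i) := by
  simp only [sub_mul, mul_sub, sum_sub_distrib, sum_const, nsmul_eq_mul]
  simp only [← mul_sum, ← sum_mul]
  ring

lemma abs_sum_mul_le_of_abs_sub_le {κ : Type*} {s : Finset κ} {d b : κ → ℝ} {c : ℝ}
    (hd : ∑ i ∈ s, d i = 0) (hb : ∀ i ∈ s, ∀ j ∈ s, |b i - b j| ≤ c * |d i - d j|) :
    |∑ i ∈ s, d i * b i| ≤ c * ∑ i ∈ s, d i ^ 2 := by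
  rcases s.eq_empty_or_nonempty with rfl | hs
  · simp
  have hpairs : ∀ b' : κ → ℝ, ∑ i ∈ s, ∑ j ∈ s, (d i - d j) * (b' i - b' j) =
      2 * #s * ∑ i ∈ s, d i * b' i := fun b' ↦ by rw [sum_sum_sub_mul_sub, hd]; ring
  have hcard : (0 : ℝ) < 2 * #s := by have := hs.card_pos; positivity
  rw [← mul_le_mul_iff_right₀ hcard]
  calc 2 * #s * |∑ i ∈ s, d i * b i|
      = |∑ i ∈ s, ∑ j ∈ s, (d i - d j) * (b i - b j)| := by
        rw [hpairs, abs_mul, abs_of_pos hcard]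
    _ ≤ ∑ i ∈ s, ∑ j ∈ s, |(d i - d j) * (b i - b j)| :=
        (abs_sum_le_sum_abs _ _).trans (sum_le_sum fun i _ ↦ abs_sum_le_sum_abs _ _)
    _ ≤ ∑ i ∈ s, ∑ j ∈ s, c * ((d i - d j) * (d i - d j)) := by
        refine sum_le_sum fun i hi ↦ sum_le_sum fun j hj ↦ ?_
        rw [abs_mul, ← abs_mul_abs_self (d i - d j), mul_left_comm]
        exact mul_le_mul_of_nonneg_left (hb i hi j hj) (abs_nonneg _)
    _ = 2 * #s * (c * ∑ i ∈ s, d i ^ 2) := by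
        simp only [← mul_sum]
        rw [hpairs d, mul_left_comm]
        simp only [← pow_two]

lemma abs_sum_mul_bernoulliExp_erase_le {s : Finset ι} {p d : ι → ℝ} {φ : ℕ → ℝ} {c t : ℝ}
    (ht : 0 ≤ t) (hp : ∀ i ∈ s, p i ∈ Set.Icc 0 1) (hd : ∑ i ∈ s, d i = 0)
    (hpd : ∀ i ∈ s, ∀ j ∈ s, p j - p i = t * (d j - d i))
    (hφ : ∀ j, j + 1 < #s → |(Δ_[1] φ) j| ≤ c) :
    |∑ i ∈ s, d i * bernoulliExp (s.erase i) p φ| ≤ c * t * ∑ i ∈ s, d i ^ 2 := by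
  refine abs_sum_mul_le_of_abs_sub_le hd fun i hi j hj ↦ ?_
  rcases eq_or_ne i j with rfl | hij
  · simp
  have hcard : #((s.erase i).erase j) + 2 = #s := by
    rw [card_erase_of_mem (mem_erase.2 ⟨hij.symm, hj⟩), card_erase_of_mem hi]
    have := one_lt_card.2 ⟨i, hi, j, hj, hij⟩
    lia
  rw [bernoulliExp_erase_sub hi hj hij, hpd i hi j hj, abs_mul, abs_mul, abs_of_nonneg ht,
    mul_comm, mul_assoc c, abs_sub_comm (d j)]
  refine mul_le_mul_of_nonneg_right (abs_bernoulliExp_le (fun l hl ↦ hp l ?_) fun l hl ↦ hφ l ?_)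
    (by positivity)
  · exact mem_of_mem_erase (mem_of_mem_erase hl)
  · lia

theorem abs_bernoulliExp_sub_const_le {s : Finset ι} {p : ι → ℝ} {a c : ℝ} {φ : ℕ → ℝ}
    (hp : ∀ i ∈ s, p i ∈ Set.Icc 0 1) (ha : a ∈ Set.Icc 0 1) (hsum : ∑ i ∈ s, (p i - a) = 0)
    (hφ : ∀ j, |(Δ_[1] (Δ_[1] φ)) j| ≤ c) :
    |bernoulliExp s p φ - bernoulliExp s (fun _ ↦ a) φ| ≤ c / 2 * ∑ i ∈ s, (p i - a) ^ 2 := by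
  have hderiv : ∀ t : ℝ, HasDerivAt (fun t ↦ bernoulliExp s (fun i ↦ a + t * (p i - a)) φ)
      (∑ i ∈ s, (p i - a) *
        bernoulliExp (s.erase i) (fun i ↦ a + t * (p i - a)) (Δ_[1] φ)) t := fun t ↦
    hasDerivAt_bernoulliExp
      (fun i _ ↦ by simpa using ((hasDerivAt_id t).mul_const (p i - a)).const_add a) φ
  have hbound : ∀ t ∈ Set.Ico (0 : ℝ) 1, ‖∑ i ∈ s, (p i - a) *
      bernoulliExp (s.erase i) (fun i ↦ a + t * (p i - a)) (Δ_[1] φ)‖ ≤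
        c * t * ∑ i ∈ s, (p i - a) ^ 2 := fun t ht ↦ by
    refine abs_sum_mul_bernoulliExp_erase_le ht.1 (fun i hi ↦ ?_) hsum (fun i _ j _ ↦ by ring)
      fun j _ ↦ hφ j
    exact (convex_Icc (0 : ℝ) 1).add_smul_sub_mem ha (hp i hi) ⟨ht.1, ht.2.le⟩
  have hmain := image_norm_le_of_norm_deriv_right_le_deriv_boundary (x := 1)
    (fun t _ ↦ ((hderiv t).sub_const _).continuousAt.continuousWithinAt)
    (fun t _ ↦ ((hderiv t).sub_const (bernoulliExp s (fun _ ↦ a) φ)).hasDerivWithinAt)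
    (B := fun t ↦ c / 2 * (∑ i ∈ s, (p i - a) ^ 2) * t ^ 2) (a := 0) (b := 1) (by simp)
    (fun t ↦ ((hasDerivAt_pow 2 t).const_mul _).congr_deriv (by push_cast; ring)) hbound (by simp)
  simpa using hmain

end BernoulliSums

section Binomial

/-- The probability of `j` under the binomial law with `n` trials and success probability `p`; as a
function of `p` it is a Bernstein polynomial. -/
noncomputable def binPMF (n : ℕ) (p : ℝ) (j : ℕ) : ℝ := (bernsteinPolynomial ℝ n j).eval p

/-- The probability of `{0, …, k - 1}` under the binomial law with `n` trials and success
probability `p`. -/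
noncomputable def binCDF (n : ℕ) (p : ℝ) (k : ℕ) : ℝ := ∑ j ∈ range k, binPMF n p j

variable {n : ℕ} {p : ℝ}

lemma binPMF_eq (n : ℕ) (p : ℝ) (j : ℕ) :
    binPMF n p j = n.choose j * p ^ j * (1 - p) ^ (n - j) := by
  simp [binPMF, bernsteinPolynomial]

lemma binPMF_nonneg (n : ℕ) (hp : p ∈ Set.Icc 0 1) (j : ℕ) : 0 ≤ binPMF n p j := by
  have := hp.1
  have := sub_nonneg.2 hp.2
  rw [binPMF_eq]
  positivity

lemma binPMF_pos (hp : p ∈ Set.Ioo 0 1) {j : ℕ} (hj : j ≤ n) : 0 < binPMF n p j := by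
  have := hp.1
  have := sub_pos.2 hp.2
  have := Nat.choose_pos hj
  rw [binPMF_eq]
  positivity

lemma binPMF_one_sub (p : ℝ) {j : ℕ} (hj : j ≤ n) : binPMF n (1 - p) j = binPMF n p (n - j) := by
  simp [binPMF, ← bernsteinPolynomial.flip ℝ n j hj, Polynomial.eval_comp]

lemma binPMF_eq_zero_of_lt (p : ℝ) {j : ℕ} (hj : n < j) : binPMF n p j = 0 := by
  simp [binPMF_eq, Nat.choose_eq_zero_of_lt hj]

lemma binPMF_succ_mul (n : ℕ) (p : ℝ) (j : ℕ) :
    (n - j) * p * binPMF n p j = (j + 1) * (1 - p) * binPMF n p (j + 1) := by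
  rcases lt_or_ge j n with hj | hj
  · have hchoose : (n.choose (j + 1) : ℝ) * (j + 1) = n.choose j * (n - j) := by
      rw [← Nat.cast_sub hj.le]
      exact_mod_cast Nat.choose_succ_right_eq n j
    rw [binPMF_eq, binPMF_eq, show n - j = n - (j + 1) + 1 by lia, pow_succ, pow_succ]
    linear_combination (-(p ^ j * p * (1 - p) ^ (n - (j + 1)) * (1 - p))) * hchoose
  · rw [binPMF_eq_zero_of_lt p (Nat.lt_succ_of_le hj)]
    rcases hj.eq_or_lt with rfl | hj
    · simp
    · simp [binPMF_eq_zero_of_lt p hj]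

lemma mul_binPMF (n : ℕ) (p : ℝ) (j : ℕ) :
    p * (n + 1) * binPMF n p j = (j + 1) * binPMF (n + 1) p (j + 1) := by
  have hchoose : ((n : ℝ) + 1) * n.choose j = (n + 1).choose (j + 1) * (j + 1) := by
    exact_mod_cast Nat.add_one_mul_choose_eq n j
  rw [binPMF_eq, binPMF_eq, Nat.add_sub_add_right, pow_succ]
  linear_combination (p ^ j * p * (1 - p) ^ (n - j)) * hchoose

lemma binCDF_succ (n : ℕ) (p : ℝ) (k : ℕ) : binCDF n p (k + 1) = binCDF n p k + binPMF n p k :=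
  sum_range_succ _ _

lemma binCDF_zero (n : ℕ) (p : ℝ) : binCDF n p 0 = 0 := sum_range_zero _

lemma binCDF_eq_one_of_lt (p : ℝ) {k : ℕ} (hk : n < k) : binCDF n p k = 1 := by
  calc binCDF n p k = ∑ j ∈ range (n + 1), binPMF n p j :=
        (sum_subset (range_subset_range.2 hk) fun j _ hj ↦
          binPMF_eq_zero_of_lt p (by simpa [Nat.lt_succ_iff] using hj)).symm
    _ = 1 := by simp [binPMF, ← Polynomial.eval_finsetSum, bernsteinPolynomial.sum]

lemma binCDF_nonneg (n : ℕ) (hp : p ∈ Set.Icc 0 1) (k : ℕ) : 0 ≤ binCDF n p k :=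
  sum_nonneg fun j _ ↦ binPMF_nonneg n hp j

lemma monotone_binCDF (n : ℕ) (hp : p ∈ Set.Icc 0 1) : Monotone (binCDF n p) :=
  monotone_nat_of_le_succ fun k ↦ by
    rw [binCDF_succ]
    exact le_add_of_nonneg_right (binPMF_nonneg n hp k)

lemma binCDF_le_one (n : ℕ) (hp : p ∈ Set.Icc 0 1) (k : ℕ) : binCDF n p k ≤ 1 :=
  (monotone_binCDF n hp (le_max_left k (n + 1))).trans_eq
    (binCDF_eq_one_of_lt p (le_max_right k (n + 1)))

lemma one_sub_binCDF (p : ℝ) {k : ℕ} (hk : k ≤ n + 1) :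
    1 - binCDF n p k = binCDF n (1 - p) (n + 1 - k) := by
  calc 1 - binCDF n p k = ∑ j ∈ Ico k (n + 1), binPMF n p j := by
        rw [sum_Ico_eq_sub _ hk, ← binCDF_eq_one_of_lt p n.lt_succ_self]
        rfl
    _ = ∑ j ∈ Ico 0 (n + 1 - k), binPMF n p (n - j) := by
        rw [sum_Ico_reflect _ _ (by lia), Nat.sub_sub_self hk, Nat.sub_zero]
    _ = binCDF n (1 - p) (n + 1 - k) := by
        rw [binCDF, range_eq_Ico]
        exact sum_congr rfl fun j hj ↦ (binPMF_one_sub p (by have := (mem_Ico.1 hj).2; lia)).symm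

lemma sum_range_binPMF_succ_le (n : ℕ) (hp : p ∈ Set.Icc 0 1) (j : ℕ) :
    ∑ l ∈ range j, ((l : ℝ) + 1) * binPMF n p (l + 1) ≤ j * binCDF n p (j + 1) := by
  rw [binCDF, sum_range_succ', mul_add, mul_sum]
  refine le_add_of_le_of_nonneg (sum_le_sum fun l hl ↦ ?_) ?_
  · gcongr
    · exact binPMF_nonneg n hp _
    · exact_mod_cast mem_range.1 hl
  · exact mul_nonneg (Nat.cast_nonneg j) (binPMF_nonneg n hp 0)

lemma binCDF_mul_le_binCDF_succ_mul (n : ℕ) (hp : p ∈ Set.Icc 0 1) (j : ℕ) :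
    binCDF n p j * ((n - j) * p) ≤ binCDF n p (j + 1) * (j * (1 - p)) := by
  calc binCDF n p j * ((n - j) * p) ≤ ∑ l ∈ range j, (n - l) * p * binPMF n p l := by
        rw [binCDF, sum_mul]
        refine sum_le_sum fun l hl ↦ ?_
        rw [mul_comm]
        have : (l : ℝ) ≤ j := by exact_mod_cast (mem_range.1 hl).le
        gcongr
        exacts [binPMF_nonneg n hp l, hp.1]
    _ = (1 - p) * ∑ l ∈ range j, ((l : ℝ) + 1) * binPMF n p (l + 1) := by
        rw [mul_sum]
        exact sum_congr rfl fun l _ ↦ by rw [binPMF_succ_mul]; ring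
    _ ≤ (1 - p) * (j * binCDF n p (j + 1)) :=
        mul_le_mul_of_nonneg_left (sum_range_binPMF_succ_le n hp j) (sub_nonneg.2 hp.2)
    _ = binCDF n p (j + 1) * (j * (1 - p)) := by ring

lemma one_sub_binCDF_succ_mul_le (hp : p ∈ Set.Icc 0 1) {j : ℕ} (hj : j ≤ n) :
    (1 - binCDF n p (j + 1)) * (j * (1 - p)) ≤ (1 - binCDF n p j) * ((n - j) * p) := by
  have h := binCDF_mul_le_binCDF_succ_mul n (Set.Icc.mem_iff_one_sub_mem.1 hp) (n - j)
  rwa [Nat.cast_sub hj, sub_sub_cancel, sub_sub_cancel,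
    ← Nat.sub_add_comm hj, ← one_sub_binCDF p (by lia), ← Nat.add_sub_add_right n 1 j,
    ← one_sub_binCDF p (by lia)] at h

lemma binCDF_mul_le (n : ℕ) (hp : p ∈ Set.Icc 0 1) (j : ℕ) :
    binCDF n p j * ((n + 1) * p) ≤ j * binCDF (n + 1) p (j + 1) := by
  rw [binCDF, sum_mul]
  refine le_trans (sum_le_sum fun l _ ↦ ?_) (sum_range_binPMF_succ_le (n + 1) hp j)
  rw [← mul_binPMF]
  exact le_of_eq (by ring)

lemma one_sub_binCDF_succ_mul_le_succ (hp : p ∈ Set.Icc 0 1) {j : ℕ} (hj : j ≤ n) :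
    (1 - binCDF n p (j + 1)) * ((n + 1) * (1 - p)) ≤ (n - j) * (1 - binCDF (n + 1) p (j + 1)) := by
  have h := binCDF_mul_le n (Set.Icc.mem_iff_one_sub_mem.1 hp) (n - j)
  rwa [Nat.cast_sub hj, ← Nat.sub_add_comm hj, ← Nat.add_sub_add_right (n + 1) 1 j,
    ← one_sub_binCDF p (by lia), ← Nat.add_sub_add_right n 1 j, ← one_sub_binCDF p (by lia)] at h

lemma one_sub_binCDF_div_add_binCDF_div_le (hp : p ∈ Set.Ioo 0 1) {j : ℕ} (hj₀ : 0 < j)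
    (hj : j < n) :
    (1 - binCDF n p (j + 1)) / ((n - j) * p) + binCDF n p j / (j * (1 - p)) ≤
      1 / (n * (p * (1 - p))) := by
  have hp' := Set.Ioo_subset_Icc_self hp
  have hp₀ : 0 < p := hp.1
  have hq₀ : 0 < 1 - p := sub_pos.2 hp.2
  have hnj : (0 : ℝ) < n - j := sub_pos.2 (by exact_mod_cast hj)
  have hn : (0 : ℝ) < n := by exact_mod_cast hj₀.trans hj
  have htail : (1 - binCDF n p (j + 1)) / ((n - j) * p) ≤
      (1 - binCDF (n + 1) p (j + 1)) / ((n + 1) * (p * (1 - p))) := by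
    rw [div_le_div_iff₀ (by positivity) (by positivity)]
    linarith [mul_le_mul_of_nonneg_right (one_sub_binCDF_succ_mul_le_succ hp' hj.le) hp₀.le]
  have hhead : binCDF n p j / (j * (1 - p)) ≤
      binCDF (n + 1) p (j + 1) / ((n + 1) * (p * (1 - p))) := by
    rw [div_le_div_iff₀ (by positivity) (by positivity)]
    linarith [mul_le_mul_of_nonneg_right (binCDF_mul_le n hp' j) hq₀.le]
  calc _ ≤ _ := add_le_add htail hhead
    _ = 1 / ((n + 1) * (p * (1 - p))) := by rw [← add_div, sub_add_cancel]
    _ ≤ 1 / (n * (p * (1 - p))) := by gcongr; linarith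

end Binomial

section Stein

variable {n : ℕ} {p : ℝ}

/-- The indicator function of `{0, …, k - 1}`. -/
noncomputable def below (k j : ℕ) : ℝ := if j < k then 1 else 0

lemma abs_fwdDiff_fwdDiff_below_le (k j : ℕ) : |(Δ_[1] (Δ_[1] (below k))) j| ≤ 1 := by
  simp only [fwdDiff, below]
  split_ifs <;> first | lia | norm_num

/-- The solution `f` of the Stein equation `(n - j) p f (j + 1) - j (1 - p) f j = below k j - E`
of the binomial law, where `E = binCDF n p k` is the mean of `below k`; its value at `j = 0`, which
the equation leaves free, is `0` because of the division by `0`. -/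
noncomputable def steinSol (n : ℕ) (p : ℝ) (k j : ℕ) : ℝ :=
  binCDF n p (min j k) * (1 - binCDF n p (max j k)) / (binPMF n p j * (j * (1 - p)))

lemma steinSol_succ (n : ℕ) (p : ℝ) (k j : ℕ) :
    steinSol n p k (j + 1) = binCDF n p (min (j + 1) k) * (1 - binCDF n p (max (j + 1) k)) /
      (binPMF n p j * ((n - j) * p)) := by
  rw [steinSol, mul_comm (binPMF n p j), binPMF_succ_mul, Nat.cast_succ, mul_comm (binPMF n p _)]

lemma stein_equation (hp : p ∈ Set.Ioo 0 1) (k : ℕ) {j : ℕ} (hj : j ≤ n) :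
    (n - j) * p * steinSol n p k (j + 1) - j * (1 - p) * steinSol n p k j =
      below k j - binCDF n p k := by
  have hb := (binPMF_pos hp hj).ne'
  have hup : (n - j) * p * steinSol n p k (j + 1) =
      binCDF n p (min (j + 1) k) * (1 - binCDF n p (max (j + 1) k)) / binPMF n p j := by
    rcases hj.eq_or_lt with rfl | hj
    · rw [binCDF_eq_one_of_lt p (lt_max_of_lt_left j.lt_succ_self)]; simp
    · have : (n : ℝ) - j ≠ 0 := (sub_pos.2 (by exact_mod_cast hj)).ne'
      have := hp.1.ne'
      rw [steinSol_succ]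
      field_simp
  have hlow : j * (1 - p) * steinSol n p k j =
      binCDF n p (min j k) * (1 - binCDF n p (max j k)) / binPMF n p j := by
    rcases Nat.eq_zero_or_pos j with rfl | hj
    · simp [binCDF_zero]
    · have : (j : ℝ) ≠ 0 := by positivity
      have := (sub_pos.2 hp.2).ne'
      rw [steinSol]
      field_simp
  rw [hup, hlow, below]
  split_ifs with h
  · rw [min_eq_left h, max_eq_right (Nat.succ_le_of_lt h), min_eq_left h.le, max_eq_right h.le,
      binCDF_succ]
    field_simp; ring
  · rw [min_eq_right (by lia), max_eq_left (by lia), min_eq_right (by lia), max_eq_left (by lia),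
      binCDF_succ]
    field_simp; ring

lemma abs_div_sub_div_le {b u v t x y : ℝ} (hb : 0 < b) (hu : 0 ≤ u) (ht : 0 ≤ t) (htv : t ≤ v)
    (hux : u / y ≤ (u + b) / x) (hvx : v / x ≤ (v + b) / y) :
    |(u + b) * t / (b * x) - u * t / (b * y)| ≤ v / x + u / y := by
  have hdiff : (u + b) * t / (b * x) - u * t / (b * y) = t * ((u + b) / x - u / y) / b := by
    rw [mul_comm b, mul_comm b, ← div_div, ← div_div, ← sub_div]
    ring
  have hgap : 0 ≤ (u + b) / x - u / y := sub_nonneg.2 hux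
  rw [hdiff, abs_of_nonneg (div_nonneg (mul_nonneg ht hgap) hb.le), div_le_iff₀ hb]
  calc t * ((u + b) / x - u / y) ≤ v * ((u + b) / x - u / y) :=
        mul_le_mul_of_nonneg_right htv hgap
    _ = (v / x + u / y) * b - u * ((v + b) / y - v / x) := by ring
    _ ≤ (v / x + u / y) * b := sub_le_self _ (mul_nonneg hu (sub_nonneg.2 hvx))

lemma abs_steinSol_succ_sub_le (hp : p ∈ Set.Ioo 0 1) (k : ℕ) {j : ℕ}
    (hj₀ : 0 < j) (hj : j < n) :
    |steinSol n p k (j + 1) - steinSol n p k j| ≤ 1 / (n * (p * (1 - p))) := by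
  refine le_trans ?_ (one_sub_binCDF_div_add_binCDF_div_le hp hj₀ hj)
  have hp' := Set.Ioo_subset_Icc_self hp
  have hx : 0 < (n - j) * p := mul_pos (sub_pos.2 (by exact_mod_cast hj)) hp.1
  have hy : 0 < j * (1 - p) := mul_pos (by exact_mod_cast hj₀) (sub_pos.2 hp.2)
  have hhead : binCDF n p j / (j * (1 - p)) ≤ (binCDF n p j + binPMF n p j) / ((n - j) * p) := by
    rw [div_le_div_iff₀ hy hx, ← binCDF_succ]
    exact binCDF_mul_le_binCDF_succ_mul n hp' j
  have hsucc : 1 - binCDF n p (j + 1) + binPMF n p j = 1 - binCDF n p j := by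
    rw [binCDF_succ]; ring
  have htail : (1 - binCDF n p (j + 1)) / ((n - j) * p) ≤
      (1 - binCDF n p (j + 1) + binPMF n p j) / (j * (1 - p)) := by
    rw [div_le_div_iff₀ hx hy, hsucc]
    exact one_sub_binCDF_succ_mul_le hp' hj.le
  have hb := binPMF_pos hp hj.le
  rw [steinSol_succ, steinSol]
  rcases lt_or_ge j k with h | h
  · rw [min_eq_left (Nat.succ_le_of_lt h), max_eq_right (Nat.succ_le_of_lt h), min_eq_left h.le,
      max_eq_right h.le, binCDF_succ n p j]
    exact abs_div_sub_div_le hb (binCDF_nonneg n hp' j) (sub_nonneg.2 (binCDF_le_one n hp' k))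
      (by rw [← binCDF_succ]; exact sub_le_sub_left (monotone_binCDF n hp' h) 1) hhead
      (by rw [← binCDF_succ]; exact htail)
  · rw [min_eq_right (by lia), max_eq_left (by lia), min_eq_right (by lia), max_eq_left (by lia),
      ← hsucc, mul_comm (binCDF n p k), mul_comm (binCDF n p k), abs_sub_comm]
    exact (abs_div_sub_div_le hb (sub_nonneg.2 (binCDF_le_one n hp' (j + 1)))
      (binCDF_nonneg n hp' k) (monotone_binCDF n hp' h) htail hhead).trans_eq (add_comm _ _)

end Stein

section Ehm

variable {ι : Type*} [DecidableEq ι]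

lemma bernoulliExp_below_const (s : Finset ι) (a : ℝ) (k : ℕ) :
    bernoulliExp s (fun _ ↦ a) (below k) = binCDF #s a k := by
  have hsum : bernoulliExp s (fun _ ↦ a) (below k) =
      ∑ j ∈ range (#s + 1), if j < k then binPMF #s a j else 0 := by
    rw [bernoulliExp_apply, sum_congr rfl fun T hT ↦ by
      rw [prod_const, prod_const, card_sdiff_of_subset (mem_powerset.1 hT)],
      sum_powerset_apply_card fun j ↦ a ^ j * (1 - a) ^ (#s - j) * below k j]
    refine sum_congr rfl fun j _ ↦ ?_
    rw [nsmul_eq_mul, below, binPMF_eq]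
    split_ifs <;> ring
  rw [hsum, ← sum_filter, binCDF]
  refine sum_subset (fun j hj ↦ mem_range.2 (mem_filter.1 hj).2) fun j hjk hj ↦ ?_
  exact binPMF_eq_zero_of_lt a (by simp only [mem_filter, mem_range] at hj hjk; lia)

lemma bernoulliExp_below_sub_binCDF {s : Finset ι} (p : ι → ℝ) {a : ℝ} (ha : a ∈ Set.Ioo 0 1)
    (k : ℕ) :
    bernoulliExp s p (below k) - binCDF #s a k =
      -∑ i ∈ s, (p i - a) * bernoulliExp (s.erase i) p fun j ↦ steinSol #s a k (j + 1) := by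
  have hstein : bernoulliExp s p (below k) - binCDF #s a k =
      bernoulliExp s p (a • (fun j : ℕ ↦ ((#s : ℝ) - j) * steinSol #s a k (j + 1)) -
        (1 - a) • fun j : ℕ ↦ (j : ℝ) * steinSol #s a k j) := by
    rw [← bernoulliExp_const s p (binCDF #s a k), ← map_sub]
    refine bernoulliExp_congr p fun j hj ↦ ?_
    simp only [Pi.sub_apply, Pi.smul_apply, smul_eq_mul]
    rw [← stein_equation ha k hj]
    ring
  rw [hstein, map_sub, map_smul, map_smul, bernoulliExp_natCast_mul,
    bernoulliExp_card_sub_mul s p fun j ↦ steinSol #s a k (j + 1), smul_eq_mul, smul_eq_mul,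
    mul_sum, mul_sum, ← sum_sub_distrib, ← sum_neg_distrib]
  exact sum_congr rfl fun i _ ↦ by ring

theorem abs_bernoulliExp_below_sub_binCDF_le {s : Finset ι} {p : ι → ℝ} {a : ℝ}
    (hp : ∀ i ∈ s, p i ∈ Set.Icc 0 1) (ha : a ∈ Set.Ioo 0 1) (hsum : ∑ i ∈ s, (p i - a) = 0)
    (k : ℕ) :
    |bernoulliExp s p (below k) - binCDF #s a k| ≤
      1 / (#s * (a * (1 - a))) * ∑ i ∈ s, (p i - a) ^ 2 := by
  rw [bernoulliExp_below_sub_binCDF p ha, abs_neg, ← mul_one (1 / _)]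
  exact abs_sum_mul_bernoulliExp_erase_le zero_le_one hp hsum (fun i _ j _ ↦ by ring)
    fun l hl ↦ abs_steinSol_succ_sub_le ha k l.succ_pos hl

/-- The factor in front of the sum of squared deviations when the law of a sum of `n` independent
Bernoulli variables with mean success probability `a` is approximated by the binomial law. -/
noncomputable def ehmWeight (n : ℕ) (a : ℝ) : ℝ := 1 / max 2 (n * (a * (1 - a)))

theorem abs_bernoulliExp_below_sub_binCDF_le_ehmWeight {s : Finset ι} {p : ι → ℝ} {a : ℝ}
    (hp : ∀ i ∈ s, p i ∈ Set.Icc 0 1) (ha : a ∈ Set.Icc 0 1) (hsum : ∑ i ∈ s, (p i - a) = 0)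
    (k : ℕ) :
    |bernoulliExp s p (below k) - binCDF #s a k| ≤
      ehmWeight #s a * ∑ i ∈ s, (p i - a) ^ 2 := by
  rcases le_total (#s * (a * (1 - a))) 2 with h | h
  · rw [ehmWeight, max_eq_left h, ← bernoulliExp_below_const s a k]
    exact abs_bernoulliExp_sub_const_le hp ha hsum (abs_fwdDiff_fwdDiff_below_le k)
  · rw [ehmWeight, max_eq_right h]
    refine abs_bernoulliExp_below_sub_binCDF_le hp ⟨ha.1.lt_of_ne ?_, ha.2.lt_of_ne ?_⟩ hsum k
    · rintro rfl; norm_num at h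
    · rintro rfl; norm_num at h

end Ehm

section KolmogorovSmirnov

variable {μ ν : Measure ℝ}

lemma ksDist_nonneg (μ ν : Measure ℝ) : 0 ≤ ksDist μ ν := Real.iSup_nonneg fun _ ↦ abs_nonneg _

lemma eq_Iic_or_Iio_of_isLowerSet {A : Set ℝ} (hA : IsLowerSet A) (hne : A.Nonempty)
    (hbdd : BddAbove A) : ∃ b, A = Set.Iic b ∨ A = Set.Iio b := by
  have hlub := isLUB_csSup hne hbdd
  refine ⟨sSup A, ?_⟩
  by_cases hmem : sSup A ∈ A
  · exact Or.inl (Set.Subset.antisymm (fun x hx ↦ hlub.1 hx) fun x hx ↦ hA hx hmem)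
  · refine Or.inr (Set.Subset.antisymm (fun x hx ↦ ?_) fun x hx ↦ ?_)
    · exact (hlub.1 hx).lt_of_ne (ne_of_mem_of_not_mem hx hmem)
    · obtain ⟨y, hy, hxy⟩ := exists_lt_of_lt_csSup hne hx
      exact hA hxy.le hy

lemma tendsto_measureReal_Iic_Iio (ρ : Measure ℝ) [IsFiniteMeasure ρ] {u : ℕ → ℝ} {b : ℝ}
    (hu : StrictMono u) (hub : ∀ n, u n < b) (hlim : Filter.Tendsto u Filter.atTop (nhds b)) :
    Filter.Tendsto (fun n ↦ ρ.real (Set.Iic (u n))) Filter.atTop (nhds (ρ.real (Set.Iio b))) := by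
  rw [← iUnion_Iic_eq_Iio_of_lt_of_tendsto hub hlim]
  exact (ENNReal.tendsto_toReal (measure_ne_top _ _)).comp
    (tendsto_measure_iUnion_atTop fun i j h ↦ Set.Iic_subset_Iic.2 (hu.monotone h))

section FiniteMeasure

variable [IsFiniteMeasure μ] [IsFiniteMeasure ν]

lemma abs_measureReal_Iic_sub_le (b : ℝ) :
    |μ.real (Set.Iic b) - ν.real (Set.Iic b)| ≤ ksDist μ ν := by
  refine le_ciSup (f := fun b ↦ |μ.real (Set.Iic b) - ν.real (Set.Iic b)|)
    ⟨μ.real Set.univ + ν.real Set.univ, ?_⟩ b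
  rintro _ ⟨x, rfl⟩
  refine (abs_sub _ _).trans (add_le_add ?_ ?_) <;>
    exact (abs_of_nonneg measureReal_nonneg).trans_le (measureReal_mono (Set.subset_univ _))

lemma abs_measureReal_Iio_sub_le (b : ℝ) :
    |μ.real (Set.Iio b) - ν.real (Set.Iio b)| ≤ ksDist μ ν := by
  obtain ⟨u, hu, hub, hlim⟩ := exists_seq_strictMono_tendsto b
  exact le_of_tendsto ((tendsto_measureReal_Iic_Iio μ hu hub hlim).sub
    (tendsto_measureReal_Iic_Iio ν hu hub hlim)).abs
    (Filter.Eventually.of_forall fun n ↦ abs_measureReal_Iic_sub_le _)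

end FiniteMeasure

variable [IsProbabilityMeasure μ] [IsProbabilityMeasure ν]

lemma abs_measureReal_sub_le_of_isLowerSet {A : Set ℝ} (hA : IsLowerSet A) :
    |μ.real A - ν.real A| ≤ ksDist μ ν := by
  rcases A.eq_empty_or_nonempty with rfl | hne
  · simpa using ksDist_nonneg μ ν
  by_cases hbdd : BddAbove A
  · obtain ⟨b, rfl | rfl⟩ := eq_Iic_or_Iio_of_isLowerSet hA hne hbdd
    · exact abs_measureReal_Iic_sub_le b
    · exact abs_measureReal_Iio_sub_le b
  · have huniv : A = Set.univ := Set.eq_univ_of_forall fun x ↦ by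
      obtain ⟨y, hy, hxy⟩ := not_bddAbove_iff.1 hbdd x
      exact hA hxy.le hy
    simpa [huniv] using ksDist_nonneg μ ν

lemma integrable_of_antitone_of_mem_Icc {g : ℝ → ℝ} {a b : ℝ} (hg : Antitone g)
    (h : ∀ x, g x ∈ Set.Icc a b) : Integrable g μ :=
  Integrable.of_mem_Icc a b hg.measurable.aemeasurable (Filter.Eventually.of_forall h)

lemma abs_integral_sub_le_of_antitone {g : ℝ → ℝ} {c : ℝ} (hg : Antitone g)
    (h : ∀ x, g x ∈ Set.Icc 0 c) : |∫ x, g x ∂μ - ∫ x, g x ∂ν| ≤ c * ksDist μ ν := by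
  have hc : 0 ≤ c := (h 0).1.trans (h 0).2
  have hlayer (ρ : Measure ℝ) [IsProbabilityMeasure ρ] :
      ∫ x, g x ∂ρ = ∫ t in (0 : ℝ)..c, ρ.real {x | t ≤ g x} := by
    rw [intervalIntegral.integral_of_le hc]
    exact (integrable_of_antitone_of_mem_Icc hg h).integral_eq_integral_Ioc_meas_le
      (Filter.Eventually.of_forall fun x ↦ (h x).1) (Filter.Eventually.of_forall fun x ↦ (h x).2)
  have hint (ρ : Measure ℝ) [IsProbabilityMeasure ρ] :
      IntervalIntegrable (fun t ↦ ρ.real {x | t ≤ g x}) volume 0 c :=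
    Antitone.intervalIntegrable fun s t hst ↦ measureReal_mono fun x (hx : t ≤ g x) ↦ hst.trans hx
  have hbound := intervalIntegral.norm_integral_le_of_norm_le_const (a := 0) (b := c)
    (f := fun t ↦ μ.real {x | t ≤ g x} - ν.real {x | t ≤ g x}) (C := ksDist μ ν) fun t _ ↦
      abs_measureReal_sub_le_of_isLowerSet fun x y hyx (hx : t ≤ g x) ↦ hx.trans (hg hyx)
  rw [hlayer μ, hlayer ν, ← intervalIntegral.integral_sub (hint μ) (hint ν), mul_comm]
  rwa [sub_zero, abs_of_nonneg hc, Real.norm_eq_abs] at hbound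

theorem abs_integral_sub_le_of_antitoneOn {g : ℝ → ℝ} {a b l r : ℝ} (hlr : l ≤ r)
    (hg : AntitoneOn g (Set.Icc l r)) (hgab : Set.MapsTo g (Set.Icc l r) (Set.Icc a b))
    (hμ : ∀ᵐ x ∂μ, x ∈ Set.Icc l r) (hν : ∀ᵐ x ∂ν, x ∈ Set.Icc l r) :
    |∫ x, g x ∂μ - ∫ x, g x ∂ν| ≤ (b - a) * ksDist μ ν := by
  set f : ℝ → ℝ := fun x ↦ g (Set.projIcc l r hlr x) - a with hf
  have hf_anti : Antitone f := fun x y hxy ↦ sub_le_sub_right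
    (hg (Subtype.prop _) (Subtype.prop _) (Set.monotone_projIcc hlr hxy)) a
  have hf_mem : ∀ x, f x ∈ Set.Icc 0 (b - a) := fun x ↦
    have h := hgab (Set.projIcc l r hlr x).2
    ⟨sub_nonneg.2 h.1, sub_le_sub_right h.2 a⟩
  have hfg (ρ : Measure ℝ) [IsProbabilityMeasure ρ] (hρ : ∀ᵐ x ∂ρ, x ∈ Set.Icc l r) :
      ∫ x, g x ∂ρ = ∫ x, f x ∂ρ + a := by
    have hae : g =ᵐ[ρ] fun x ↦ f x + a := by
      filter_upwards [hρ] with x hx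
      simp [hf, Set.projIcc_of_mem hlr hx]
    rw [integral_congr_ae hae, integral_add (integrable_of_antitone_of_mem_Icc hf_anti hf_mem)
      (integrable_const a)]
    simp
  rw [hfg μ hμ, hfg ν hν, add_sub_add_right_eq_sub]
  exact abs_integral_sub_le_of_antitone hf_anti hf_mem

theorem abs_integral_sub_le_of_monotoneOn {g : ℝ → ℝ} {a b l r : ℝ} (hlr : l ≤ r)
    (hg : MonotoneOn g (Set.Icc l r)) (hgab : Set.MapsTo g (Set.Icc l r) (Set.Icc a b))
    (hμ : ∀ᵐ x ∂μ, x ∈ Set.Icc l r) (hν : ∀ᵐ x ∂ν, x ∈ Set.Icc l r) :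
    |∫ x, g x ∂μ - ∫ x, g x ∂ν| ≤ (b - a) * ksDist μ ν := by
  have h := abs_integral_sub_le_of_antitoneOn hlr hg.neg (a := -b) (b := -a)
    (fun x hx ↦ ⟨neg_le_neg (hgab hx).2, neg_le_neg (hgab hx).1⟩) hμ hν
  simp only [integral_neg] at h
  rwa [neg_sub_neg, neg_sub_neg, abs_sub_comm] at h

end KolmogorovSmirnov

section Uniform

instance : IsProbabilityMeasure uniform01 := ⟨by simp [uniform01]⟩

lemma integral_uniform01 (g : ℝ → ℝ) : ∫ x, g x ∂uniform01 = ∫ x in (0 : ℝ)..1, g x := by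
  rw [uniform01, intervalIntegral.integral_of_le zero_le_one, integral_Ioc_eq_integral_Ioo]

lemma ae_uniform01_mem_Icc : ∀ᵐ x ∂uniform01, x ∈ Set.Icc 0 1 :=
  (ae_restrict_mem measurableSet_Ioo).mono fun _ hx ↦ Set.Ioo_subset_Icc_self hx

lemma continuous_binPMF (n j : ℕ) : Continuous fun p ↦ binPMF n p j :=
  (bernsteinPolynomial ℝ n j).continuous

lemma continuous_binCDF (n k : ℕ) : Continuous fun p ↦ binCDF n p k :=
  continuous_finsetSum _ fun j _ ↦ continuous_binPMF n j

lemma hasDerivAt_binCDF (n k : ℕ) (p : ℝ) :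
    HasDerivAt (fun p ↦ binCDF (n + 1) p (k + 1)) (-((n + 1) * binPMF n p k)) p := by
  induction k with
  | zero =>
    simp only [binCDF_succ, binCDF_zero, zero_add]
    refine ((bernsteinPolynomial ℝ (n + 1) 0).hasDerivAt p).congr_deriv ?_
    rw [bernsteinPolynomial.derivative_zero]
    simp [binPMF]
    ring
  | succ k ih =>
    simp only [binCDF_succ _ _ (k + 1)]
    refine (ih.add ((bernsteinPolynomial ℝ (n + 1) (k + 1)).hasDerivAt p)).congr_deriv ?_
    rw [bernsteinPolynomial.derivative_succ]
    simp [binPMF]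
    ring

lemma antitoneOn_binCDF (n k : ℕ) :
    AntitoneOn (fun p ↦ binCDF n p k) (Set.Icc 0 1) := by
  match n, k with
  | n, 0 => simpa only [binCDF_zero] using antitoneOn_const
  | 0, k + 1 => simpa only [binCDF_eq_one_of_lt _ k.succ_pos] using antitoneOn_const
  | n + 1, k + 1 =>
    refine antitoneOn_of_hasDerivWithinAt_nonpos (convex_Icc _ _)
      (fun p _ ↦ (hasDerivAt_binCDF n k p).continuousAt.continuousWithinAt)
      (fun p _ ↦ (hasDerivAt_binCDF n k p).hasDerivWithinAt) fun p hp ↦ ?_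
    rw [interior_Icc] at hp
    have := binPMF_nonneg n (Set.Ioo_subset_Icc_self hp) k
    exact neg_nonpos.2 (by positivity)

lemma binPMF_at_zero (n j : ℕ) : binPMF n 0 j = if j = 0 then 1 else 0 :=
  bernsteinPolynomial.eval_at_0 ℝ n j

lemma binPMF_at_one (n j : ℕ) : binPMF n 1 j = if j = n then 1 else 0 :=
  bernsteinPolynomial.eval_at_1 ℝ n j

lemma integral_binPMF {n j : ℕ} (hj : j ≤ n) :
    ∫ p in (0 : ℝ)..1, binPMF n p j = 1 / (n + 1) := by
  have h := intervalIntegral.integral_eq_sub_of_hasDerivAt (a := 0) (b := 1)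
    (fun p _ ↦ hasDerivAt_binCDF n j p)
    (((continuous_binPMF n j).const_mul _).neg.intervalIntegrable _ _)
  have hzero : binCDF (n + 1) 0 (j + 1) = 1 := by simp [binCDF, binPMF_at_zero]
  have hone : binCDF (n + 1) 1 (j + 1) = 0 :=
    sum_eq_zero fun l hl ↦ by rw [binPMF_at_one, if_neg (by have := mem_range.1 hl; lia)]
  rw [hzero, hone, intervalIntegral.integral_neg, intervalIntegral.integral_const_mul] at h
  field_simp
  linarith

lemma integral_binCDF {n k : ℕ} (hk : k ≤ n + 1) :
    ∫ p in (0 : ℝ)..1, binCDF n p k = k / (n + 1) := by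
  simp only [binCDF]
  rw [intervalIntegral.integral_finsetSum fun j _ ↦ (continuous_binPMF n j).intervalIntegrable _ _,
    sum_congr rfl fun j hj ↦ integral_binPMF (n := n) (by have := mem_range.1 hj; lia)]
  simp [div_eq_mul_inv]

lemma abs_integral_binCDF_sub_le {μ : Measure ℝ} [IsProbabilityMeasure μ]
    (hμ : ∀ᵐ x ∂μ, x ∈ Set.Icc 0 1) {n k : ℕ} (hk : k ≤ n + 1) :
    |∫ x, binCDF n x k ∂μ - k / (n + 1)| ≤ ksDist μ uniform01 := by
  have h := abs_integral_sub_le_of_antitoneOn zero_le_one (antitoneOn_binCDF n k)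
    (fun x hx ↦ ⟨binCDF_nonneg n hx k, binCDF_le_one n hx k⟩) hμ ae_uniform01_mem_Icc
  rwa [integral_uniform01, integral_binCDF hk, sub_zero, one_mul] at h

end Uniform

section EhmWeight

variable (n : ℕ)

lemma ehmWeight_mem_Icc (x : ℝ) : ehmWeight n x ∈ Set.Icc 0 (1 / 2) :=
  ⟨by unfold ehmWeight; positivity, one_div_le_one_div_of_le two_pos (le_max_left _ _)⟩

lemma continuous_ehmWeight : Continuous (ehmWeight n) :=
  continuous_const.div (by fun_prop) fun x ↦ by positivity

lemma ehmWeight_le_of_le {x y : ℝ} (h : x * (1 - x) ≤ y * (1 - y)) :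
    ehmWeight n y ≤ ehmWeight n x := by
  unfold ehmWeight
  gcongr

lemma antitone_ehmWeight_min : Antitone fun x ↦ ehmWeight n (min x (1 / 2)) := fun x y hxy ↦ by
  have hmin : min x (1 / 2) ≤ min y (1 / 2) := min_le_min_right _ hxy
  have hhalf : min y (1 / 2) ≤ 1 / 2 := min_le_right _ _
  exact ehmWeight_le_of_le n (by nlinarith)

lemma monotone_ehmWeight_max : Monotone fun x ↦ ehmWeight n (max x (1 / 2)) := fun x y hxy ↦ by
  have hmax : max x (1 / 2) ≤ max y (1 / 2) := max_le_max_right _ hxy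
  have hhalf : 1 / 2 ≤ max x (1 / 2) := le_max_right _ _
  exact ehmWeight_le_of_le n (by nlinarith)

lemma integral_ehmWeight_eq (ρ : Measure ℝ) [IsProbabilityMeasure ρ] :
    ∫ x, ehmWeight n x ∂ρ = ∫ x, ehmWeight n (min x (1 / 2)) ∂ρ +
      ∫ x, ehmWeight n (max x (1 / 2)) ∂ρ - ehmWeight n (1 / 2) := by
  have hint {g : ℝ → ℝ} (hg : Continuous g) : Integrable (fun x ↦ ehmWeight n (g x)) ρ :=
    .of_mem_Icc 0 (1 / 2) ((continuous_ehmWeight n).comp hg).measurable.aemeasurable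
      (Filter.Eventually.of_forall fun x ↦ ehmWeight_mem_Icc n (g x))
  have hsplit : ∀ x, ehmWeight n x =
      ehmWeight n (min x (1 / 2)) + ehmWeight n (max x (1 / 2)) - ehmWeight n (1 / 2) := fun x ↦ by
    rcases le_total x (1 / 2) with h | h
    · rw [min_eq_left h, max_eq_right h, add_sub_cancel_right]
    · rw [min_eq_right h, max_eq_left h, add_sub_cancel_left]
  have hmin : Integrable (fun x ↦ ehmWeight n (min x (1 / 2))) ρ := hint (by fun_prop)
  have hmax : Integrable (fun x ↦ ehmWeight n (max x (1 / 2))) ρ := hint (by fun_prop)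
  rw [integral_congr_ae (Filter.Eventually.of_forall hsplit),
    integral_sub (hmin.fun_add hmax) (integrable_const _), integral_add hmin hmax]
  simp

lemma integral_ehmWeight_le_add_ksDist {μ : Measure ℝ} [IsProbabilityMeasure μ]
    (hμ : ∀ᵐ x ∂μ, x ∈ Set.Icc 0 1) :
    ∫ x, ehmWeight n x ∂μ ≤ (∫ x in (0 : ℝ)..1, ehmWeight n x) + ksDist μ uniform01 := by
  have hmin := abs_integral_sub_le_of_antitoneOn zero_le_one
    ((antitone_ehmWeight_min n).antitoneOn _) (fun x _ ↦ ehmWeight_mem_Icc n _) hμ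
    ae_uniform01_mem_Icc
  have hmax := abs_integral_sub_le_of_monotoneOn zero_le_one
    ((monotone_ehmWeight_max n).monotoneOn _) (fun x _ ↦ ehmWeight_mem_Icc n _) hμ
    ae_uniform01_mem_Icc
  rw [← integral_uniform01, integral_ehmWeight_eq, integral_ehmWeight_eq]
  linarith [(abs_le.1 hmin).2, (abs_le.1 hmax).2]

lemma integral_ehmWeight_le_sub {a b : ℝ} (hab : a ≤ b) :
    ∫ x in a..b, ehmWeight n x ≤ b - a := by
  have h := intervalIntegral.integral_mono_on hab
    ((continuous_ehmWeight n).intervalIntegrable a b)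
    (continuous_const.intervalIntegrable (μ := volume) a b)
    fun x _ ↦ (ehmWeight_mem_Icc n x).2.trans one_half_lt_one.le
  simpa using h

lemma intervalIntegrable_one_div_mul_one_sub (c : ℝ) {a b : ℝ} (hc : 0 < c) (ha : a ∈ Set.Ioo 0 1)
    (hb : b ∈ Set.Ioo 0 1) :
    IntervalIntegrable (fun x ↦ 1 / (c * (x * (1 - x)))) volume a b := by
  refine ContinuousOn.intervalIntegrable (continuousOn_const.div (by fun_prop) fun x hx ↦ ?_)
  obtain ⟨hx₀, hx₁⟩ := Set.ordConnected_Ioo.uIcc_subset ha hb hx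
  have := sub_pos.2 hx₁
  positivity

lemma integral_one_div_mul_one_sub {c r : ℝ} (hc : 0 < c) (hr : r ∈ Set.Ico 0 1) :
    ∫ x in ((1 - r) / 2)..((1 + r) / 2), 1 / (c * (x * (1 - x))) =
      2 / c * Real.log ((1 + r) / (1 - r)) := by
  obtain ⟨hr₀, hr₁⟩ := hr
  have hleft : (1 - r) / 2 ∈ Set.Ioo 0 1 := ⟨by linarith, by linarith⟩
  have hright : (1 + r) / 2 ∈ Set.Ioo 0 1 := ⟨by linarith, by linarith⟩
  have hderiv : ∀ x ∈ Set.uIcc ((1 - r) / 2) ((1 + r) / 2),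
      HasDerivAt (fun x ↦ 1 / c * (Real.log x - Real.log (1 - x))) (1 / (c * (x * (1 - x)))) x := by
    intro x hx
    obtain ⟨hx₀, hx₁⟩ := Set.ordConnected_Ioo.uIcc_subset hleft hright hx
    have := sub_ne_zero.2 hx₁.ne'
    refine (((Real.hasDerivAt_log hx₀.ne').sub
      (((hasDerivAt_id x).const_sub 1).log this)).const_mul (1 / c)).congr_deriv ?_
    simp only [id]
    field_simp
    ring
  rw [intervalIntegral.integral_eq_sub_of_hasDerivAt hderiv
    (intervalIntegrable_one_div_mul_one_sub c hc hleft hright),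
    show 1 - (1 + r) / 2 = (1 - r) / 2 by ring, show 1 - (1 - r) / 2 = (1 + r) / 2 by ring,
    Real.log_div (by linarith) two_ne_zero, Real.log_div (by linarith) two_ne_zero,
    Real.log_div (by linarith) (by linarith)]
  ring

lemma integral_ehmWeight_le_IConst : ∫ x in (0 : ℝ)..1, ehmWeight n x ≤ IConst n := by
  unfold IConst
  split_ifs with hn
  · simpa using integral_ehmWeight_le_sub n zero_le_one
  have hn₄ : (4 : ℝ) < n := by exact_mod_cast not_le.1 hn
  have hn₀ : (0 : ℝ) < n := by linarith
  set r := √(1 - 4 / (n : ℝ))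
  have hr₀ : 0 ≤ r := Real.sqrt_nonneg _
  have hr₁ : r < 1 := by
    rw [Real.sqrt_lt' one_pos, one_pow, sub_lt_self_iff]
    positivity
  have hint : ∀ a b, IntervalIntegrable (ehmWeight n) volume a b := fun a b ↦
    (continuous_ehmWeight n).intervalIntegrable a b
  have hmid : ∫ x in ((1 - r) / 2)..((1 + r) / 2), ehmWeight n x ≤
      2 / n * Real.log ((1 + r) / (1 - r)) := by
    rw [← integral_one_div_mul_one_sub hn₀ ⟨hr₀, hr₁⟩]
    refine intervalIntegral.integral_mono_on (by linarith) (hint _ _)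
      (intervalIntegrable_one_div_mul_one_sub n hn₀ ⟨by linarith, by linarith⟩
        ⟨by linarith, by linarith⟩) fun x hx ↦ ?_
    have hx₀ : 0 < x := by linarith [hx.1]
    have hx₁ : 0 < 1 - x := by linarith [hx.2]
    exact one_div_le_one_div_of_le (by positivity) (le_max_right _ _)
  rw [← intervalIntegral.integral_add_adjacent_intervals (hint 0 ((1 - r) / 2)) (hint _ 1),
    ← intervalIntegral.integral_add_adjacent_intervals (hint _ ((1 + r) / 2)) (hint _ 1)]
  have hleft := integral_ehmWeight_le_sub n (by linarith : 0 ≤ (1 - r) / 2)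
  have hright := integral_ehmWeight_le_sub n (by linarith : (1 + r) / 2 ≤ 1)
  linarith

lemma integral_ehmWeight_le {μ : Measure ℝ} [IsProbabilityMeasure μ]
    (hμ : ∀ᵐ x ∂μ, x ∈ Set.Icc 0 1) :
    ∫ x, ehmWeight n x ∂μ ≤ IConst n + ksDist μ uniform01 :=
  (integral_ehmWeight_le_add_ksDist n hμ).trans
    (add_le_add_left (integral_ehmWeight_le_IConst n) _)

end EhmWeight

section Chernoff

/-- Chernoff's bound for the probability that a sum of independent Bernoulli variables with mean
`c + y` is at most `c`. For `c = 0` the junk value `y / 0 = 0` is harmless. -/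
noncomputable def chernoffTail (c : ℕ) (y : ℝ) : ℝ := (y / c + 1) ^ c * Real.exp (-y)

lemma continuous_chernoffTail (c : ℕ) : Continuous (chernoffTail c) := by
  unfold chernoffTail; fun_prop

lemma chernoffTail_nonneg (c : ℕ) {y : ℝ} (hy : 0 ≤ y) : 0 ≤ chernoffTail c y := by
  unfold chernoffTail; positivity

lemma chernoffTail_zero (c : ℕ) : chernoffTail c 0 = 1 := by simp [chernoffTail]

lemma add_one_mul_exp_neg_le {x y : ℝ} (hx : 0 ≤ x) (hxy : x ≤ y) :
    (y + 1) * Real.exp (-y) ≤ (x + 1) * Real.exp (-x) := by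
  have hexp := Real.add_one_le_exp (y - x)
  calc (y + 1) * Real.exp (-y) ≤ ((x + 1) * Real.exp (y - x)) * Real.exp (-y) := by
        gcongr
        nlinarith
    _ = (x + 1) * Real.exp (-x) := by
        rw [mul_assoc, ← Real.exp_add, sub_add_eq_add_sub, add_neg_cancel, zero_sub]

lemma antitoneOn_chernoffTail (c : ℕ) : AntitoneOn (chernoffTail c) (Set.Ici 0) := by
  intro x hx y hy hxy
  rw [Set.mem_Ici] at hx hy
  rcases eq_or_ne c 0 with rfl | hc
  · simpa [chernoffTail] using hxy
  have hpow : ∀ z : ℝ, chernoffTail c z = ((z / c + 1) * Real.exp (-(z / c))) ^ c := fun z ↦ by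
    rw [chernoffTail, mul_pow, ← Real.exp_nat_mul]
    congr 2
    field_simp
  rw [hpow, hpow]
  exact pow_le_pow_left₀ (by positivity)
    (add_one_mul_exp_neg_le (by positivity) (by gcongr)) c

lemma integrableOn_pow_mul_exp_neg (r : ℕ) :
    IntegrableOn (fun y : ℝ ↦ y ^ r * Real.exp (-y)) (Set.Ioi 0) := by
  refine (Real.GammaIntegral_convergent (s := r + 1) (by positivity)).congr_fun (fun y _ ↦ ?_)
    measurableSet_Ioi
  simp [Real.rpow_natCast, mul_comm]

lemma integral_pow_mul_exp_neg (r : ℕ) :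
    ∫ y in Set.Ioi (0 : ℝ), y ^ r * Real.exp (-y) = r.factorial := by
  rw [← Real.Gamma_nat_eq_factorial, Real.Gamma_eq_integral (by positivity)]
  refine setIntegral_congr_fun measurableSet_Ioi fun y _ ↦ ?_
  simp [Real.rpow_natCast, mul_comm]

lemma chernoffTail_eq_sum (c : ℕ) : chernoffTail c = fun y ↦
    ∑ r ∈ range (c + 1), (c.choose r / (c : ℝ) ^ r) * (y ^ r * Real.exp (-y)) := by
  ext y
  rw [chernoffTail, add_pow, sum_mul]
  refine sum_congr rfl fun r _ ↦ ?_
  rw [one_pow, div_pow]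
  ring

lemma integrableOn_chernoffTail (c : ℕ) : IntegrableOn (chernoffTail c) (Set.Ioi 0) := by
  rw [chernoffTail_eq_sum]
  exact integrable_finsetSum _ fun r _ ↦ (integrableOn_pow_mul_exp_neg r).const_mul _

lemma integral_chernoffTail (c : ℕ) :
    ∫ y in Set.Ioi (0 : ℝ), chernoffTail c y =
      ∑ r ∈ range (c + 1), (c.descFactorial r : ℝ) / (c : ℝ) ^ r := by
  simp only [chernoffTail_eq_sum]
  rw [integral_finsetSum _ fun r _ ↦ (integrableOn_pow_mul_exp_neg r).const_mul _]
  refine sum_congr rfl fun r _ ↦ ?_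
  rw [integral_const_mul, integral_pow_mul_exp_neg, div_mul_eq_mul_div,
    Nat.descFactorial_eq_factorial_mul_choose]
  push_cast
  ring

lemma descFactorial_succ_div_pow_le {c r : ℕ} (hr : r < c) :
    (c.descFactorial (r + 1) : ℝ) / (c : ℝ) ^ (r + 1) ≤ 1 - r / c := by
  have hc : (0 : ℝ) < c := by exact_mod_cast (Nat.zero_le r).trans_lt hr
  have hrc : (r : ℝ) ≤ c := by exact_mod_cast hr.le
  rw [div_le_iff₀ (by positivity), Nat.descFactorial_succ, Nat.cast_mul, Nat.cast_sub hr.le]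
  calc ((c : ℝ) - r) * c.descFactorial r ≤ (c - r) * (c : ℝ) ^ r := by
        gcongr
        exact_mod_cast Nat.descFactorial_le_pow c r
    _ = (1 - r / c) * (c : ℝ) ^ (r + 1) := by rw [pow_succ]; field_simp

lemma sum_range_one_sub_div_le (c : ℕ) : ∑ r ∈ range c, (1 - (r : ℝ) / c) ≤ (c + 1) / 2 := by
  rcases eq_or_ne c 0 with rfl | hc
  · norm_num
  have hgauss : (∑ r ∈ range c, (r : ℝ)) = c * (c - 1) / 2 := by
    rw [← Nat.cast_pred (Nat.pos_of_ne_zero hc), eq_div_iff two_ne_zero, ← Nat.cast_sum]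
    exact_mod_cast Finset.sum_range_id_mul_two c
  rw [sum_sub_distrib, ← sum_div, hgauss, sum_const, card_range, nsmul_one]
  field_simp
  linarith

lemma integral_chernoffTail_le (c : ℕ) :
    ∫ y in Set.Ioi (0 : ℝ), chernoffTail c y ≤ ((c : ℝ) + 3) / 2 := by
  have hterms := sum_le_sum fun r hr ↦ descFactorial_succ_div_pow_le (mem_range.1 hr : r < c)
  rw [integral_chernoffTail, sum_range_succ', Nat.descFactorial_zero, Nat.cast_one, pow_zero,
    div_one]
  linarith [sum_range_one_sub_div_le c]

/-- Chernoff's bound, as a function of the mean `x`, for the probability that a sum of independent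
Bernoulli variables is at most `c`; it is the trivial bound `1` for `x ≤ c`. -/
noncomputable def chernoffBound (c : ℕ) (x : ℝ) : ℝ := chernoffTail c (max (x - c) 0)

lemma chernoffBound_of_le {c : ℕ} {x : ℝ} (h : x ≤ c) : chernoffBound c x = 1 := by
  rw [chernoffBound, max_eq_right (sub_nonpos.2 h), chernoffTail_zero]

lemma chernoffBound_of_ge {c : ℕ} {x : ℝ} (h : c ≤ x) :
    chernoffBound c x = chernoffTail c (x - c) := by
  rw [chernoffBound, max_eq_left (sub_nonneg.2 h)]

lemma continuous_chernoffBound (c : ℕ) : Continuous (chernoffBound c) :=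
  (continuous_chernoffTail c).comp (by fun_prop)

lemma antitone_chernoffBound (c : ℕ) : Antitone (chernoffBound c) := fun _ _ h ↦
  antitoneOn_chernoffTail c (Set.mem_Ici.2 (le_max_right _ _)) (Set.mem_Ici.2 (le_max_right _ _))
    (max_le_max_right _ (sub_le_sub_right h _))

lemma chernoffBound_mem_Icc (c : ℕ) (x : ℝ) : chernoffBound c x ∈ Set.Icc 0 1 := by
  have hmax : 0 ≤ max (x - c) 0 := le_max_right _ _
  exact ⟨chernoffTail_nonneg c hmax,
    (antitoneOn_chernoffTail c Set.self_mem_Ici hmax hmax).trans_eq (chernoffTail_zero c)⟩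

lemma integral_chernoffBound_zero_self_le (c : ℕ) : ∫ x in (0 : ℝ)..c, chernoffBound c x ≤ c := by
  have h := intervalIntegral.integral_mono_on c.cast_nonneg
    ((continuous_chernoffBound c).intervalIntegrable 0 c)
    (continuous_const.intervalIntegrable (μ := volume) _ _) fun x _ ↦ (chernoffBound_mem_Icc c x).2
  simpa using h

lemma integral_chernoffBound_self_le {c : ℕ} {b : ℝ} (hcb : c ≤ b) :
    ∫ x in (c : ℝ)..b, chernoffBound c x ≤ (c + 3) / 2 := by
  have hshift : ∫ x in (c : ℝ)..b, chernoffBound c x = ∫ x in (c : ℝ)..b, chernoffTail c (x - c) :=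
    intervalIntegral.integral_congr fun x hx ↦ by
      rw [Set.uIcc_of_le hcb] at hx
      exact chernoffBound_of_ge hx.1
  rw [hshift, intervalIntegral.integral_comp_sub_right, sub_self,
    intervalIntegral.integral_of_le (sub_nonneg.2 hcb)]
  refine (setIntegral_mono_set (integrableOn_chernoffTail c) ?_
    Set.Ioc_subset_Ioi_self.eventuallyLE).trans (integral_chernoffTail_le c)
  filter_upwards [self_mem_ae_restrict measurableSet_Ioi] with y hy
  exact chernoffTail_nonneg c (le_of_lt hy)

lemma integral_chernoffBound_le {c n : ℕ} (hn : 0 < n) (hc : c ≤ n) :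
    ∫ p in (0 : ℝ)..1, chernoffBound c (n - n * p) ≤ 3 / 2 * ((c + 1) / n) := by
  have hn' : (0 : ℝ) < n := by exact_mod_cast hn
  have hint : ∀ a b, IntervalIntegrable (chernoffBound c) volume a b := fun a b ↦
    (continuous_chernoffBound c).intervalIntegrable a b
  have hscale : (n : ℝ) * (3 / 2 * ((c + 1) / n)) = c + (c + 3) / 2 := by field_simp; ring
  rw [intervalIntegral.integral_comp_sub_mul _ hn'.ne', mul_one, mul_zero, sub_self, sub_zero,
    ← intervalIntegral.integral_add_adjacent_intervals (hint 0 c) (hint c n), smul_eq_mul,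
    inv_mul_le_iff₀ hn', hscale]
  exact add_le_add (integral_chernoffBound_zero_self_le c)
    (integral_chernoffBound_self_le (by exact_mod_cast hc))

lemma integral_chernoffBound_le_add_ksDist {μ : Measure ℝ} [IsProbabilityMeasure μ]
    (hμ : ∀ᵐ x ∂μ, x ∈ Set.Icc 0 1) {c n : ℕ} (hn : 0 < n) (hc : c ≤ n) :
    ∫ p, chernoffBound c (n - n * p) ∂μ ≤ 3 / 2 * ((c + 1) / n) + ksDist μ uniform01 := by
  have hmono : Monotone fun p : ℝ ↦ chernoffBound c (n - n * p) := fun x y h ↦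
    antitone_chernoffBound c (by gcongr)
  have h := abs_integral_sub_le_of_monotoneOn zero_le_one (hmono.monotoneOn _)
    (fun x _ ↦ chernoffBound_mem_Icc c _) hμ ae_uniform01_mem_Icc
  rw [integral_uniform01] at h
  linarith [(abs_le.1 h).2, integral_chernoffBound_le hn hc]

section BernoulliTail

variable {ι : Type*} [DecidableEq ι] {s : Finset ι} {p : ι → ℝ}

lemma below_nonneg (k j : ℕ) : 0 ≤ below k j := by unfold below; split_ifs <;> norm_num

lemma below_le_one (k j : ℕ) : below k j ≤ 1 := by unfold below; split_ifs <;> norm_num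

lemma pow_mul_bernoulliExp_below_le (hp : ∀ i ∈ s, p i ∈ Set.Icc 0 1) (c : ℕ) {x : ℝ}
    (hx : x ∈ Set.Icc 0 1) :
    x ^ c * bernoulliExp s p (below (c + 1)) ≤ Real.exp (-((1 - x) * ∑ i ∈ s, p i)) := by
  calc x ^ c * bernoulliExp s p (below (c + 1)) =
      bernoulliExp s p (x ^ c • below (c + 1)) := by
        rw [map_smul, smul_eq_mul]
    _ ≤ bernoulliExp s p fun j ↦ x ^ j := by
        refine bernoulliExp_mono hp fun j _ ↦ ?_
        rw [Pi.smul_apply, smul_eq_mul, below]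
        split_ifs with hj
        · exact (mul_one _).trans_le (pow_le_pow_of_le_one hx.1 hx.2 (Nat.lt_succ_iff.1 hj))
        · exact (mul_zero _).trans_le (pow_nonneg hx.1 j)
    _ = ∏ i ∈ s, (1 - p i + p i * x) := bernoulliExp_pow s p x
    _ ≤ ∏ i ∈ s, Real.exp (-((1 - x) * p i)) := by
        refine prod_le_prod (fun i hi ↦ ?_) fun i _ ↦ ?_
        · exact add_nonneg (sub_nonneg.2 (hp i hi).2) (mul_nonneg (hp i hi).1 hx.1)
        · linarith [Real.add_one_le_exp (-((1 - x) * p i))]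
    _ = Real.exp (-((1 - x) * ∑ i ∈ s, p i)) := by
        rw [← Real.exp_sum, sum_neg_distrib, ← mul_sum]

theorem bernoulliExp_below_succ_le_chernoffBound (hp : ∀ i ∈ s, p i ∈ Set.Icc 0 1) (c : ℕ) :
    bernoulliExp s p (below (c + 1)) ≤ chernoffBound c (∑ i ∈ s, p i) := by
  set x := ∑ i ∈ s, p i with hx
  rcases le_or_gt x c with h | h
  · rw [chernoffBound_of_le h, ← bernoulliExp_const s p 1]
    exact bernoulliExp_mono hp fun j _ ↦ below_le_one _ _
  have hx₀ : 0 < x := c.cast_nonneg.trans_lt h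
  have hmarkov := pow_mul_bernoulliExp_below_le (s := s) hp c (x := c / x)
    ⟨by positivity, (div_le_one hx₀).2 h.le⟩
  rw [← hx, show (1 - c / x) * x = x - c by field_simp] at hmarkov
  rw [chernoffBound_of_ge h.le, chernoffTail]
  rcases eq_or_ne c 0 with rfl | hc
  · simpa using hmarkov
  have hinv : (x - c) / c + 1 = (c / x)⁻¹ := by field_simp; ring
  rwa [hinv, inv_pow, le_inv_mul_iff₀ (by positivity)]

theorem one_sub_bernoulliExp_below_le_chernoffBound (hp : ∀ i ∈ s, p i ∈ Set.Icc 0 1) {c k : ℕ}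
    (hkc : k + c = #s) :
    1 - bernoulliExp s p (below k) ≤ chernoffBound c (#s - ∑ i ∈ s, p i) := by
  have hreflect : 1 - bernoulliExp s p (below k) =
      bernoulliExp s (fun i ↦ 1 - p i) (below (c + 1)) := by
    nth_rw 1 [← bernoulliExp_const s p 1]
    rw [← map_sub, bernoulliExp_reflect]
    refine bernoulliExp_congr _ fun j hj ↦ ?_
    simp only [Pi.sub_apply, below]
    split_ifs <;> first | lia | norm_num
  rw [hreflect]
  refine (bernoulliExp_below_succ_le_chernoffBound
    (fun i hi ↦ ⟨sub_nonneg.2 (hp i hi).2, sub_le_self _ (hp i hi).1⟩) c).trans_eq ?_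
  rw [sum_sub_distrib, sum_const, nsmul_one]

end BernoulliTail

end Chernoff

lemma le_orderStat_iff {m : ℕ} (v : Fin m → ℝ) (k : ℕ) (x : ℝ) :
    (x : EReal) ≤ orderStat v k ↔ #{i | v i < x} < k := by
  unfold orderStat
  split_ifs with hk₀ h
  · simp [hk₀]
  · have hcard : #{i | v (Tuple.sort v i) < x} = #{i | v i < x} :=
      card_equiv (Tuple.sort v) fun i ↦ by simp
    have hlt := Tuple.lt_card_lt_iff_apply_lt_of_monotone (j := ⟨k - 1, h⟩) (a := x)
      (Tuple.monotone_sort v)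
    simp only [Function.comp_apply, hcard] at hlt
    rw [EReal.coe_le_coe_iff, ← not_lt, ← hlt]
    lia
  · have hcard := card_le_univ (α := Fin m) {i | v i < x}
    rw [Fintype.card_fin] at hcard
    exact iff_of_true le_top (by lia)

lemma mem_predSet_iff {𝒳 𝒴 : Type*} {m : ℕ} (R : 𝒳 → 𝒴 → ℝ) (x : Fin m → 𝒳) (y : Fin m → 𝒴)
    (k : ℕ) (x' : 𝒳) (y' : 𝒴) :
    y' ∈ predSet R x y k x' ↔ #{i | R (x i) (y i) < R x' y'} < k :=
  le_orderStat_iff _ k _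

section IndependentEvents

variable {ι : Type*} [Fintype ι] [DecidableEq ι] {α : ι → Type*}

lemma setOf_filter_mem_eq (A : ∀ i, Set (α i)) [∀ i, DecidablePred (· ∈ A i)] (T : Finset ι) :
    {w : ∀ i, α i | ({i | w i ∈ A i} : Finset ι) = T} =
      Set.univ.pi fun i ↦ if i ∈ T then A i else (A i)ᶜ := by
  ext w
  simp only [Set.mem_ofPred_eq, Set.mem_pi, Set.mem_univ, true_imp_iff, Finset.ext_iff, mem_filter,
    mem_univ, true_and]
  refine forall_congr' fun i ↦ ?_
  split_ifs with h <;> simp [h]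

variable [∀ i, MeasurableSpace (α i)] (ρ : ∀ i, Measure (α i)) [∀ i, IsProbabilityMeasure (ρ i)]
  {A : ∀ i, Set (α i)} [∀ i, DecidablePred (· ∈ A i)]

lemma pi_real_filter_mem_eq (hA : ∀ i, MeasurableSet (A i)) (T : Finset ι) :
    (Measure.pi ρ).real {w | ({i | w i ∈ A i} : Finset ι) = T} =
      (∏ i ∈ T, (ρ i).real (A i)) * ∏ i ∈ univ \ T, (1 - (ρ i).real (A i)) := by
  rw [setOf_filter_mem_eq, measureReal_def, Measure.pi_pi, ENNReal.toReal_prod,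
    ← prod_mul_prod_compl T, ← compl_eq_univ_sdiff]
  congr 1
  · exact prod_congr rfl fun i hi ↦ by rw [if_pos hi, measureReal_def]
  · exact prod_congr rfl fun i hi ↦ by
      rw [if_neg (mem_compl.1 hi), ← measureReal_def, probReal_compl_eq_one_sub (hA i)]

lemma pi_real_card_lt (hA : ∀ i, MeasurableSet (A i)) (k : ℕ) :
    (Measure.pi ρ).real {w | #{i | w i ∈ A i} < k} =
      bernoulliExp univ (fun i ↦ (ρ i).real (A i)) (below k) := by
  have hunion : {w : ∀ i, α i | #{i | w i ∈ A i} < k} =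
      ⋃ T ∈ ({T | #T < k} : Finset (Finset ι)),
        {w | ({i | w i ∈ A i} : Finset ι) = T} := by
    ext w
    simp
  rw [hunion, measureReal_biUnion_finset, bernoulliExp_apply, powerset_univ, sum_filter]
  · refine sum_congr rfl fun T _ ↦ ?_
    rw [pi_real_filter_mem_eq ρ hA, below, mul_ite, mul_one, mul_zero]
  · exact fun T _ T' _ hne ↦ Set.disjoint_left.2 fun w hT hT' ↦ hne (hT.symm.trans hT')
  · intro T _
    rw [setOf_filter_mem_eq]
    refine MeasurableSet.univ_pi fun i ↦ ?_
    split_ifs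
    exacts [hA i, (hA i).compl]

end IndependentEvents

lemma sum_sq_sub_mean_le {ι : Type*} {s : Finset ι} {p : ι → ℝ} {a : ℝ}
    (h : ∑ i ∈ s, (p i - a) = 0) (b : ℝ) : ∑ i ∈ s, (p i - a) ^ 2 ≤ ∑ i ∈ s, (p i - b) ^ 2 := by
  have hexpand : ∀ i, (p i - b) ^ 2 = (p i - a) ^ 2 + 2 * (a - b) * (p i - a) + (a - b) ^ 2 :=
    fun i ↦ by ring
  simp only [hexpand, sum_add_distrib, ← mul_sum, h, mul_zero, add_zero]
  exact le_add_of_nonneg_right (sum_nonneg fun _ _ ↦ sq_nonneg _)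

section Rank

variable {Ω : Type*} [MeasurableSpace Ω] {P : Measure Ω} {m : ℕ} {S : Fin (m + 1) → Ω → ℝ}

/-- The number of calibration scores strictly below the test score. -/
noncomputable def testRank (S : Fin (m + 1) → Ω → ℝ) (ω : Ω) : ℕ :=
  #{j : Fin m | S j.castSucc ω < S (Fin.last m) ω}

/-- The probability that fewer than `k` calibration scores lie below the test score, given that
the latter equals `z`. -/
noncomputable def condCover (P : Measure Ω) (S : Fin (m + 1) → Ω → ℝ) (k : ℕ) (z : ℝ) : ℝ :=
  bernoulliExp univ (fun j : Fin m ↦ strictCDF P (S j.castSucc) z) (below k)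

lemma avgKS_nonneg (P : Measure Ω) (S : Fin (m + 1) → Ω → ℝ) : 0 ≤ avgKS P S := ksDist_nonneg _ _

lemma strictCDF_eq {T : Ω → ℝ} (hT : Measurable T) (z : ℝ) :
    strictCDF P T z = (P.map T).real (Set.Iio z) :=
  (map_measureReal_apply hT measurableSet_Iio).symm

lemma sum_strictCDF (hm : 1 ≤ m) (S : Fin (m + 1) → Ω → ℝ) (z : ℝ) :
    ∑ i : Fin m, strictCDF P (S i.castSucc) z = m * avgCDF P S z := by
  have : (m : ℝ) ≠ 0 := by positivity
  unfold avgCDF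
  field_simp

lemma measurableSet_card_lt (m k : ℕ) :
    MeasurableSet {x : ℝ × (Fin m → ℝ) | #{j | x.2 j < x.1} < k} := by
  have hcard : Measurable fun x : ℝ × (Fin m → ℝ) ↦ #{j | x.2 j < x.1} := by
    simp only [card_filter]
    exact Finset.measurable_sum _ fun j _ ↦ Measurable.ite
      (measurableSet_lt (by fun_prop) (by fun_prop)) measurable_const measurable_const
  exact hcard measurableSet_Iio

variable [IsProbabilityMeasure P]

lemma strictCDF_mem_Icc (T : Ω → ℝ) (z : ℝ) : strictCDF P T z ∈ Set.Icc 0 1 :=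
  ⟨measureReal_nonneg, measureReal_le_one⟩

lemma monotone_strictCDF (T : Ω → ℝ) : Monotone (strictCDF P T) := fun _ _ h ↦
  measureReal_mono fun _ hω ↦ lt_of_lt_of_le hω h

lemma monotone_avgCDF (S : Fin (m + 1) → Ω → ℝ) : Monotone (avgCDF P S) := fun _ _ h ↦
  mul_le_mul_of_nonneg_left (sum_le_sum fun _ _ ↦ monotone_strictCDF _ h) (by positivity)

lemma avgCDF_mem_Icc (S : Fin (m + 1) → Ω → ℝ) (z : ℝ) : avgCDF P S z ∈ Set.Icc 0 1 := by
  have hsum : ∑ i : Fin m, strictCDF P (S i.castSucc) z ≤ m := by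
    simpa using sum_le_sum fun (i : Fin m) (_ : i ∈ univ) ↦
      (strictCDF_mem_Icc (P := P) (S i.castSucc) z).2
  unfold avgCDF
  rw [one_div_mul_eq_div]
  exact ⟨div_nonneg (sum_nonneg fun i _ ↦ (strictCDF_mem_Icc _ _).1) m.cast_nonneg,
    div_le_one_of_le₀ hsum m.cast_nonneg⟩

lemma map_last_castSucc_eq_prod (hmeas : ∀ i, Measurable (S i)) (hindep : iIndepFun S P) :
    P.map (fun ω ↦ (S (Fin.last m) ω, fun j : Fin m ↦ S j.castSucc ω)) =
      (P.map (S (Fin.last m))).prod (Measure.pi fun j : Fin m ↦ P.map (S j.castSucc)) := by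
  have (i : Fin (m + 1)) : IsProbabilityMeasure (P.map (S i)) :=
    Measure.isProbabilityMeasure_map (hmeas i).aemeasurable
  have hsplit := measurePreserving_piFinSuccAbove (fun i ↦ P.map (S i)) (Fin.last m)
  simp only [Fin.succAbove_last] at hsplit
  rw [← hsplit.map_eq, ← hindep.map_fun_eq_pi_map fun i ↦ (hmeas i).aemeasurable,
    Measure.map_map hsplit.measurable (measurable_pi_lambda _ hmeas)]
  congr 1
  ext ω
  · simp [MeasurableEquiv.piFinSuccAbove]
  · simp [MeasurableEquiv.piFinSuccAbove, Fin.init]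

lemma real_testRank_lt_eq_integral (hmeas : ∀ i, Measurable (S i)) (hindep : iIndepFun S P)
    (k : ℕ) :
    P.real {ω | testRank S ω < k} = ∫ z, condCover P S k z ∂P.map (S (Fin.last m)) := by
  have (i : Fin (m + 1)) : IsProbabilityMeasure (P.map (S i)) :=
    Measure.isProbabilityMeasure_map (hmeas i).aemeasurable
  set E : Set (ℝ × (Fin m → ℝ)) := {x | #{j | x.2 j < x.1} < k}
  have hE : MeasurableSet E := measurableSet_card_lt m k
  have hslice : ∀ z, ((Measure.pi fun j : Fin m ↦ P.map (S j.castSucc))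
      (Prod.mk z ⁻¹' E)).toReal = condCover P S k z := fun z ↦ by
    simp only [condCover, strictCDF_eq (hmeas _)]
    exact pi_real_card_lt _ (A := fun _ ↦ Set.Iio z) (fun _ ↦ measurableSet_Iio) k
  calc P.real {ω | testRank S ω < k} =
      (P.map fun ω ↦ (S (Fin.last m) ω, fun j : Fin m ↦ S j.castSucc ω)).real E :=
        (map_measureReal_apply
          ((hmeas _).prodMk (measurable_pi_lambda _ fun j ↦ hmeas j.castSucc)) hE).symm
    _ = ∫ z, condCover P S k z ∂P.map (S (Fin.last m)) := by
        rw [map_last_castSucc_eq_prod hmeas hindep, measureReal_def, Measure.prod_apply hE,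
          ← integral_toReal (measurable_measure_prodMk_left hE).aemeasurable
            (Filter.Eventually.of_forall fun z ↦ measure_lt_top _ _)]
        simp only [hslice]

lemma measurable_condCover (S : Fin (m + 1) → Ω → ℝ) (k : ℕ) : Measurable (condCover P S k) := by
  have hCDF (j : Fin m) : Measurable (strictCDF P (S j.castSucc)) :=
    (monotone_strictCDF _).measurable
  unfold condCover
  simp only [bernoulliExp_apply]
  fun_prop

lemma condCover_mem_Icc (S : Fin (m + 1) → Ω → ℝ) (k : ℕ) (z : ℝ) :
    condCover P S k z ∈ Set.Icc 0 1 := by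
  have hp (j : Fin m) (_ : j ∈ univ) := strictCDF_mem_Icc (P := P) (S j.castSucc) z
  constructor
  · rw [← bernoulliExp_const univ (fun j : Fin m ↦ strictCDF P (S j.castSucc) z) 0]
    exact bernoulliExp_mono hp fun j _ ↦ below_nonneg k j
  · rw [← bernoulliExp_const univ (fun j : Fin m ↦ strictCDF P (S j.castSucc) z) 1]
    exact bernoulliExp_mono hp fun j _ ↦ below_le_one k j

lemma integrable_condCover (S : Fin (m + 1) → Ω → ℝ) (k : ℕ) (ν : Measure ℝ) [IsFiniteMeasure ν] :
    Integrable (condCover P S k) ν :=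
  .of_mem_Icc 0 1 (measurable_condCover S k).aemeasurable
    (Filter.Eventually.of_forall (condCover_mem_Icc S k))

lemma abs_condCover_sub_binCDF_le (hm : 1 ≤ m) (hmeas : ∀ i, Measurable (S i))
    (k : ℕ) (z : ℝ) :
    |condCover P S k z - binCDF m (avgCDF P S z) k| ≤
      ehmWeight m (avgCDF P S z) * ∑ i : Fin m, kappa P S i ^ 2 := by
  have (i : Fin (m + 1)) : IsProbabilityMeasure (P.map (S i)) :=
    Measure.isProbabilityMeasure_map (hmeas i).aemeasurable
  have hmean : ∑ i : Fin m, (strictCDF P (S i.castSucc) z - avgCDF P S z) = 0 := by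
    rw [sum_sub_distrib, sum_strictCDF hm]
    simp
  have hkappa (i : Fin m) :
      (strictCDF P (S i.castSucc) z - strictCDF P (S (Fin.last m)) z) ^ 2 ≤ kappa P S i ^ 2 := by
    rw [strictCDF_eq (hmeas _), strictCDF_eq (hmeas _)]
    exact sq_le_sq' (abs_le.1 (abs_measureReal_Iio_sub_le z)).1
      (abs_le.1 (abs_measureReal_Iio_sub_le z)).2
  have hehm := abs_bernoulliExp_below_sub_binCDF_le_ehmWeight
    (fun (i : Fin m) (_ : i ∈ univ) ↦ strictCDF_mem_Icc (S i.castSucc) z) (avgCDF_mem_Icc S z)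
    hmean k
  rw [card_univ, Fintype.card_fin] at hehm
  exact hehm.trans (mul_le_mul_of_nonneg_left ((sum_sq_sub_mean_le hmean _).trans
    (sum_le_sum fun i _ ↦ hkappa i)) (ehmWeight_mem_Icc _ _).1)

lemma isProbabilityMeasure_map_avgCDF (h : Measurable (S (Fin.last m))) :
    IsProbabilityMeasure (P.map fun ω ↦ avgCDF P S (S (Fin.last m) ω)) :=
  Measure.isProbabilityMeasure_map ((monotone_avgCDF S).measurable.comp h).aemeasurable

lemma ae_map_avgCDF_mem_Icc (h : Measurable (S (Fin.last m))) :
    ∀ᵐ x ∂P.map fun ω ↦ avgCDF P S (S (Fin.last m) ω), x ∈ Set.Icc 0 1 :=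
  (ae_map_iff ((monotone_avgCDF S).measurable.comp h).aemeasurable measurableSet_Icc).2
    (Filter.Eventually.of_forall fun _ ↦ avgCDF_mem_Icc S _)

lemma integral_comp_avgCDF (h : Measurable (S (Fin.last m))) {f : ℝ → ℝ} (hf : Continuous f) :
    ∫ z, f (avgCDF P S z) ∂P.map (S (Fin.last m)) =
      ∫ x, f x ∂P.map fun ω ↦ avgCDF P S (S (Fin.last m) ω) := by
  have havg : Measurable (avgCDF P S) := (monotone_avgCDF S).measurable
  rw [integral_map h.aemeasurable
      (show Measurable fun z ↦ f (avgCDF P S z) by fun_prop).aestronglyMeasurable,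
    integral_map (by fun_prop) hf.aestronglyMeasurable]

lemma integrable_comp_avgCDF (S : Fin (m + 1) → Ω → ℝ) (ν : Measure ℝ) [IsFiniteMeasure ν]
    {f : ℝ → ℝ} (hf : Continuous f) {a b : ℝ} (hmem : ∀ x ∈ Set.Icc 0 1, f x ∈ Set.Icc a b) :
    Integrable (fun z ↦ f (avgCDF P S z)) ν :=
  .of_mem_Icc a b (hf.measurable.comp (monotone_avgCDF S).measurable).aemeasurable
    (Filter.Eventually.of_forall fun z ↦ hmem _ (avgCDF_mem_Icc S z))

lemma abs_integral_condCover_sub_integral_binCDF_le (hm : 1 ≤ m) (hmeas : ∀ i, Measurable (S i))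
    (k : ℕ) :
    |∫ z, condCover P S k z ∂P.map (S (Fin.last m)) -
        ∫ z, binCDF m (avgCDF P S z) k ∂P.map (S (Fin.last m))| ≤
      (∑ i : Fin m, kappa P S i ^ 2) * (IConst m + avgKS P S) := by
  have hlast := hmeas (Fin.last m)
  have := Measure.isProbabilityMeasure_map (μ := P) hlast.aemeasurable
  have := isProbabilityMeasure_map_avgCDF (P := P) hlast
  have hcover := integrable_condCover (P := P) S k (P.map (S (Fin.last m)))
  have hbin := integrable_comp_avgCDF (P := P) S (P.map (S (Fin.last m))) (continuous_binCDF m k)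
    fun x hx ↦ ⟨binCDF_nonneg m hx k, binCDF_le_one m hx k⟩
  have hweight := integrable_comp_avgCDF (P := P) S (P.map (S (Fin.last m)))
    (continuous_ehmWeight m) fun x _ ↦ ehmWeight_mem_Icc m x
  rw [← integral_sub hcover hbin]
  calc |∫ z, (condCover P S k z - binCDF m (avgCDF P S z) k) ∂P.map (S (Fin.last m))|
      ≤ ∫ z, |condCover P S k z - binCDF m (avgCDF P S z) k| ∂P.map (S (Fin.last m)) :=
        abs_integral_le_integral_abs
    _ ≤ ∫ z, ehmWeight m (avgCDF P S z) * ∑ i : Fin m, kappa P S i ^ 2 ∂P.map (S (Fin.last m)) :=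
        integral_mono (hcover.sub hbin).abs (hweight.mul_const _)
          fun z ↦ abs_condCover_sub_binCDF_le hm hmeas k z
    _ = (∑ i : Fin m, kappa P S i ^ 2) *
          ∫ x, ehmWeight m x ∂P.map fun ω ↦ avgCDF P S (S (Fin.last m) ω) := by
        rw [integral_mul_const, integral_comp_avgCDF hlast (continuous_ehmWeight m), mul_comm]
    _ ≤ (∑ i : Fin m, kappa P S i ^ 2) * (IConst m + avgKS P S) :=
        mul_le_mul_of_nonneg_left (integral_ehmWeight_le m (ae_map_avgCDF_mem_Icc hlast))
          (sum_nonneg fun _ _ ↦ sq_nonneg _)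

theorem abs_real_testRank_lt_sub_le (hm : 1 ≤ m) (hmeas : ∀ i, Measurable (S i))
    (hindep : iIndepFun S P) {k : ℕ} (hk : k ≤ m + 1) :
    |P.real {ω | testRank S ω < k} - k / (m + 1)| ≤ slack P S := by
  have hlast := hmeas (Fin.last m)
  have := isProbabilityMeasure_map_avgCDF (P := P) hlast
  have hbin : |∫ z, binCDF m (avgCDF P S z) k ∂P.map (S (Fin.last m)) - k / (m + 1)| ≤
      avgKS P S := by
    rw [integral_comp_avgCDF hlast (continuous_binCDF m k)]
    exact abs_integral_binCDF_sub_le (ae_map_avgCDF_mem_Icc hlast) hk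
  rw [real_testRank_lt_eq_integral hmeas hindep]
  refine (abs_sub_le _ _ _).trans ((add_le_add
    (abs_integral_condCover_sub_integral_binCDF_le hm hmeas k) hbin).trans_eq ?_)
  rw [slack, add_comm]

lemma one_sub_condCover_le_chernoffBound (hm : 1 ≤ m) (S : Fin (m + 1) → Ω → ℝ) {k c : ℕ}
    (hkc : k + c = m) (z : ℝ) :
    1 - condCover P S k z ≤ chernoffBound c (m - m * avgCDF P S z) := by
  have h := one_sub_bernoulliExp_below_le_chernoffBound
    (fun (i : Fin m) (_ : i ∈ univ) ↦ strictCDF_mem_Icc (P := P) (S i.castSucc) z)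
    (hkc.trans (by rw [card_univ, Fintype.card_fin]))
  rwa [card_univ, Fintype.card_fin, sum_strictCDF hm] at h

lemma one_sub_le_real_testRank_lt (hm : 1 ≤ m) (hmeas : ∀ i, Measurable (S i))
    (hindep : iIndepFun S P) {k c : ℕ} (hkc : k + c = m) :
    1 - (3 / 2 * ((c + 1) / m) + avgKS P S) ≤ P.real {ω | testRank S ω < k} := by
  have hlast := hmeas (Fin.last m)
  have := Measure.isProbabilityMeasure_map (μ := P) hlast.aemeasurable
  have := isProbabilityMeasure_map_avgCDF (P := P) hlast
  have hcover := integrable_condCover (P := P) S k (P.map (S (Fin.last m)))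
  have hcont : Continuous fun x : ℝ ↦ chernoffBound c (m - m * x) :=
    (continuous_chernoffBound c).comp (by fun_prop)
  have hchernoff : ∫ z, chernoffBound c (m - m * avgCDF P S z) ∂P.map (S (Fin.last m)) ≤
      3 / 2 * ((c + 1) / m) + avgKS P S := by
    rw [integral_comp_avgCDF hlast hcont]
    exact integral_chernoffBound_le_add_ksDist (ae_map_avgCDF_mem_Icc hlast) hm (by lia)
  have hcompl : ∫ z, (1 - condCover P S k z) ∂P.map (S (Fin.last m)) =
      1 - P.real {ω | testRank S ω < k} := by
    rw [integral_sub (integrable_const 1) hcover, real_testRank_lt_eq_integral hmeas hindep]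
    simp
  have hmono := integral_mono ((integrable_const 1).sub hcover)
    (integrable_comp_avgCDF S _ hcont fun x _ ↦ chernoffBound_mem_Icc c _)
    (one_sub_condCover_le_chernoffBound hm S hkc)
  exact sub_le_comm.1 (hcompl.symm.trans_le (hmono.trans hchernoff))

theorem one_sub_le_real_testRank_lt_add_one_sub (hm : 1 ≤ m) (hmeas : ∀ i, Measurable (S i))
    (hindep : iIndepFun S P) {t : ℕ} (ht : t ≤ m) :
    1 - (3 / 2 * (t / m) + avgKS P S) ≤ P.real {ω | testRank S ω < m + 1 - t} := by
  cases t with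
  | zero =>
    have huniv : {ω | testRank S ω < m + 1 - 0} = Set.univ :=
      Set.eq_univ_of_forall fun ω ↦ Nat.lt_succ_of_le
        ((card_le_univ _).trans_eq (Fintype.card_fin m))
    rw [huniv, probReal_univ]
    simpa using avgKS_nonneg P S
  | succ c =>
    exact_mod_cast one_sub_le_real_testRank_lt hm hmeas hindep (k := m + 1 - (c + 1)) (by lia)

end Rank

lemma natCeil_mul_div_mem_Icc {n x : ℝ} (hn : 0 < n) (hx : 0 ≤ x) :
    (⌈n * x⌉₊ : ℝ) / n ∈ Set.Icc x (x + 1 / n) := by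
  constructor
  · rw [le_div_iff₀' hn]
    exact Nat.le_ceil _
  · rw [div_le_iff₀' hn, mul_add, mul_one_div_cancel hn.ne']
    exact (Nat.ceil_lt_add_one (by positivity)).le

lemma three_halves_mul_natFloor_div_le {n α : ℝ} (hn : 0 < n) (hα : 0 ≤ α) :
    3 / 2 * ((⌊2 * n * α / 3⌋₊ : ℝ) / n) ≤ α := by
  have hfloor := Nat.floor_le (show 0 ≤ 2 * n * α / 3 by positivity)
  rw [← mul_div_assoc, div_le_iff₀ hn]
  linarith

end SplitConformal

open SplitConformal in
theorem mainTheorem8_general {Ω 𝒳 𝒴 : Type*} [MeasurableSpace Ω] (P : Measure Ω)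
    [IsProbabilityMeasure P] (m : ℕ) (hm : 1 ≤ m) (α : ℝ) (hα₀ : 0 ≤ α) (hα₁ : α ≤ 1)
    (R : 𝒳 → 𝒴 → ℝ) (X : Fin (m + 1) → Ω → 𝒳) (Y : Fin (m + 1) → Ω → 𝒴)
    (S : Fin (m + 1) → Ω → ℝ) (hS : ∀ i ω, S i ω = R (X i ω) (Y i ω))
    (hmeas : ∀ i, Measurable (S i)) (hindep : iIndepFun S P) :
    (-slack P S ≤
        P.real {ω | Y (Fin.last m) ω ∈ conformalSet R
          (fun i : Fin m ↦ X i.castSucc ω) (fun i : Fin m ↦ Y i.castSucc ω) α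
          (X (Fin.last m) ω)} - (1 - α) ∧
      P.real {ω | Y (Fin.last m) ω ∈ conformalSet R
          (fun i : Fin m ↦ X i.castSucc ω) (fun i : Fin m ↦ Y i.castSucc ω) α
          (X (Fin.last m) ω)} - (1 - α) ≤ 1 / ((m : ℝ) + 1) + slack P S) ∧
    P.real {ω | Y (Fin.last m) ω ∈ modConformalSet R
          (fun i : Fin m ↦ X i.castSucc ω) (fun i : Fin m ↦ Y i.castSucc ω) α
          (X (Fin.last m) ω)} - (1 - α) ≥ -avgKS P S := by
  have hm' : (0 : ℝ) < m := by exact_mod_cast hm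
  have hrank (k : ℕ) :
      {ω | Y (Fin.last m) ω ∈ predSet R (fun i : Fin m ↦ X i.castSucc ω)
        (fun i : Fin m ↦ Y i.castSucc ω) k (X (Fin.last m) ω)} = {ω | testRank S ω < k} := by
    ext ω
    simp only [Set.mem_ofPred_eq, mem_predSet_iff, testRank, hS]
  have hceil : ⌈((m : ℝ) + 1) * (1 - α)⌉₊ ≤ m + 1 := by
    refine Nat.ceil_le.2 ?_
    push_cast
    exact mul_le_of_le_one_right (by positivity) (by linarith)
  have hfloor : ⌊2 * (m : ℝ) * α / 3⌋₊ ≤ m := Nat.floor_le_of_le (by nlinarith)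
  simp only [conformalSet, modConformalSet, hrank]
  obtain ⟨hlo, hhi⟩ := abs_le.1 (abs_real_testRank_lt_sub_le hm hmeas hindep hceil)
  obtain ⟨hk_lo, hk_hi⟩ :=
    natCeil_mul_div_mem_Icc (n := (m : ℝ) + 1) (by positivity) (sub_nonneg.2 hα₁)
  have hmod := one_sub_le_real_testRank_lt_add_one_sub hm hmeas hindep hfloor
  have ht := three_halves_mul_natFloor_div_le hm' hα₀
  exact ⟨⟨by linarith, by linarith⟩, by linarith⟩

theorem mainTheorem8 {Ω 𝒳 𝒴 : Type*} [MeasurableSpace Ω] (P : Measure Ω) [IsProbabilityMeasure P]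
    (m : ℕ) (hm : 1 ≤ m) (α : ℝ) (hα₀ : 0 < α) (hα₁ : α < 1)
    (R : 𝒳 → 𝒴 → ℝ) (X : Fin (m + 1) → Ω → 𝒳) (Y : Fin (m + 1) → Ω → 𝒴)
    (S : Fin (m + 1) → Ω → ℝ) (hS : ∀ i ω, S i ω = R (X i ω) (Y i ω))
    (hmeas : ∀ i, Measurable (S i)) (hindep : iIndepFun S P)
    (hcont : ∀ i (z : ℝ), P {ω | S i ω = z} = 0) :
    (-SplitConformal.slack P S ≤
        P.real {ω | Y (Fin.last m) ω ∈ SplitConformal.conformalSet R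
          (fun i : Fin m => X i.castSucc ω) (fun i : Fin m => Y i.castSucc ω) α
          (X (Fin.last m) ω)} - (1 - α) ∧
      P.real {ω | Y (Fin.last m) ω ∈ SplitConformal.conformalSet R
          (fun i : Fin m => X i.castSucc ω) (fun i : Fin m => Y i.castSucc ω) α
          (X (Fin.last m) ω)} - (1 - α) ≤ 1 / ((m : ℝ) + 1) + SplitConformal.slack P S) ∧
    P.real {ω | Y (Fin.last m) ω ∈ SplitConformal.modConformalSet R
          (fun i : Fin m => X i.castSucc ω) (fun i : Fin m => Y i.castSucc ω) α
          (X (Fin.last m) ω)} - (1 - α) ≥ -3 * SplitConformal.avgKS P S := by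
  obtain ⟨hconf, hmod⟩ := mainTheorem8_general P m hm α hα₀.le hα₁.le R X Y S hS hmeas hindep
  exact ⟨hconf, by linarith [SplitConformal.avgKS_nonneg P S]⟩
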